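/- **Setting.** Let $H_0,\dots,H_m$ be Hermitian $n\times n$ matrices, $S_k=-\iota H_k$, and consider $\dot X=(S_0+\sum_{k=1}^m u_k(t)S_k)X$ on $\mathrm U(n)$; assume that this system is controllable on $\mathrm U(n)$. Let $E,F\in\mathbb C^{n\times\bar n}$ have orthonormal columns, let $X_{goal}\in\mathrm U(n)$ with $X_{goal}E=F$, and let $K>0$. With the Frobenius norm put $\mathrm{pdist}(X,Y)=\|(X-Y)E\|$ and $\mathcal V(\widetilde X)=2\bar n-2\Re\,\mathrm{tr}(E^\dagger\widetilde XE)$. For a reference trajectory $\overline X$ (a solution in $\mathrm U(n)$ of the system for a continuous input $\overline u$) let $\widetilde S_k=\overline X^\dagger S_k\overline X$; the closed loop is $\dot{\widetilde X}=(\sum_k\widetilde u_k\widetilde S_k)\widetilde X$ with $\widetilde u_k=2K\Re\,\mathrm{tr}(E^\dagger\widetilde S_k\widetilde XE)$. For $\lambda\in(0,1)$, the reference trajectory is called $\lambda$-attractive in $\overline{\mathcal B}_c(I)$ on $[0,\tau]$ if $\mathcal V(\widetilde X(\tau))\le\lambda\,\mathcal V(\widetilde X(0))$ for every closed-loop solution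 with $\widetilde X(0)\in\mathrm U(n)$ and $\mathrm{pdist}(\widetilde X(0),I)\le c$. **Algorithm (RIGA with the switching strategy).** Fix $0<\alpha<\beta<2$, a horizon $T_f$, $p\ge1$, and a seed input $\overline u^0$. Let $X^0$ solve the system with input $\overline u^0$ and $X^0(0)=I$. The precomputed goal matrices are $X_g^0,\dots,X_g^p\in\mathrm U(n)$ with $X_g^0=X^0(T_f)$, $\mathrm{pdist}(X_g^{j-1},X_g^j)\le\alpha$ for $1\le j\le p$, and $X_g^p=X_{goal}^*$, where $X_{goal}^*$ minimizes $\|X^0(T_f)-Y\|$ over all $Y\in\mathrm U(n)$ with $YE=e^{\iota\phi}F$ (with either $\phi\in\mathbb R$ free or $\phi=0$ prescribed). Put $q_0=1$. In step $\ell=1,2,\dots$ let $q_\ell$ be the largest $j\in\{1,\dots,p\}$ with $j\ge q_{\ell-1}$ and $\mathrm{pdist}(X_g^j,X^{\ell-1}(T_f))\le\beta$; set $\overline X_{goal_\ell}=X_g^{q_\ell}$ and $\overline X^{\ell-1}(t)=X^{\ell-1}(t)\,X^{\ell-1}(T_f)^\dagger\,\overline X_{goal_\ell}$; let $X^\ell$,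 with $X^\ell(0)=I$, be the trajectory of the system with the input $\overline u^\ell=\overline u^{\ell-1}+\widetilde u$, where $\widetilde u_k=2K\Re\,\mathrm{tr}\big(E^\dagger\widetilde S_k\widetilde X^\ell E\big)$, $\widetilde X^\ell=(\overline X^{\ell-1})^\dagger X^\ell$ and $\widetilde S_k=(\overline X^{\ell-1})^\dagger S_k\overline X^{\ell-1}$. A switching occurs in step $\ell$ if $q_\ell>q_{\ell-1}$. Let $d_\ell=\mathrm{pdist}(\overline X_{goal_\ell},X^{\ell-1}(T_f))$ for $\ell\ge1$. **Theorem.** Let the seed be $\overline u^0_k(t)=\sum_{l=1}^M\big(a_{kl}\sin(2l\pi t/T)+b_{kl}\cos(2l\pi t/T)\big)$ with $T>0$, and suppose $|\overline u^0_k(t)|\le\mu_0$ for all $t\ge0$ and all $k$, where $\mu_0>0$. Suppose that the seed is $\lambda$-attractive for some $\lambda\in(0,1)$: for some $T_0>0$, every reference trajectory with input $\overline u^0$, whatever its initial condition in $\mathrm U(n)$, is $\lambda$-attractive in $\overline{\mathcal B}_\beta(I)$ on $[0,T_0]$. Then there are $\theta\in(0,1)$ and $\overline\mu>0$ such that for every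 $p\ge1$ there is $T^*>0$ such that for all $T_f\ge T^*$ every execution of RIGA on $[0,T_f]$ with $p$ goal matrices satisfies: (a) for every $\ell\ge0$ the reference trajectory $\overline X^\ell$ is $\theta$-attractive in $\overline{\mathcal B}_\beta(I)$ on $[0,T_f]$; (b) $d_\ell\le\beta$ for all $\ell\ge1$; $d_{\ell+1}\le\sqrt\theta\,d_\ell$ whenever $\ell\ge1$ and no switching occurs in step $\ell+1$; there is $\ell^*\ge1$ such that $q_\ell=p$, i.e. $\overline X_{goal_\ell}=X_{goal}^*$, for all $\ell\ge\ell^*$, and for these $\ell$ one has $d_{\ell+1}\le d_\ell$ and $d_\ell\le(\sqrt\theta)^{\ell-\ell^*}d_{\ell^*}$; in particular $d_\ell\to0$; (c) $|\overline u^\ell_k(t)|\le\mu_0+p\,\overline\mu\,\beta$ for all $t\in[0,T_f]$, all $k$ and all $\ell\ge0$. -/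

import Mathlib

open scoped Matrix Matrix.Norms.Frobenius

noncomputable section

namespace RIGA

/-- `n × n` complex matrices; norms of matrices are Frobenius norms throughout. -/
abbrev Mat (n : ℕ) := Matrix (Fin n) (Fin n) ℂ

/-- The group `U(n)`, as a set of matrices. -/
abbrev U (n : ℕ) : Set (Mat n) := {X | X ∈ Matrix.unitaryGroup (Fin n) ℂ}

/-- A closed quantum system: drift Hamiltonian `H₀` and control Hamiltonians `H₁, …, H_m`. -/
structure QSystem (n m : ℕ) where
  H0 : Mat n
  H : Fin m → Mat n
  isHermitian_H0 : H0.IsHermitian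
  isHermitian_H : ∀ k, (H k).IsHermitian

variable {n m nb : ℕ}

/-- `S₀ = -ι H₀`. -/
def QSystem.S0 (sys : QSystem n m) : Mat n := (-Complex.I) • sys.H0

/-- `S_k = -ι H_k`. -/
def QSystem.S (sys : QSystem n m) (k : Fin m) : Mat n := (-Complex.I) • sys.H k

/-- `S₀ + ∑ v_k S_k`. -/
def QSystem.gen (sys : QSystem n m) (v : Fin m → ℝ) : Mat n :=
  sys.S0 + ∑ k, v k • sys.S k

/-- `X` solves `X' = (S₀ + ∑ u_k S_k) X` on `[0, τ]`, with initial condition in `U(n)`. -/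
structure IsTrajectory (sys : QSystem n m) (u : ℝ → Fin m → ℝ) (τ : ℝ) (X : ℝ → Mat n) :
    Prop where
  init : X 0 ∈ U n
  deriv : ∀ t ∈ Set.Icc 0 τ, HasDerivWithinAt X (sys.gen (u t) * X t) (Set.Icc 0 τ) t

/-- Controllability on `U(n)`: every unitary matrix is reached from the identity in some finite
time by some integrable input (solutions are absolutely continuous, i.e. in integral form). -/
def QSystem.Controllable (sys : QSystem n m) : Prop :=
  ∀ Xf ∈ U n, ∃ τ : ℝ, 0 ≤ τ ∧ ∃ (u : ℝ → Fin m → ℝ) (X : ℝ → Mat n),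
    (∀ k, IntervalIntegrable (fun t => u t k) MeasureTheory.volume 0 τ) ∧
    ContinuousOn X (Set.Icc 0 τ) ∧
    (∀ t ∈ Set.Icc 0 τ, X t = 1 + ∫ s in (0 : ℝ)..t, sys.gen (u s) * X s) ∧
    X τ = Xf

/-- Partial distance `‖(X - Y) E‖`. -/
def pdist (E : Matrix (Fin n) (Fin nb) ℂ) (X Y : Mat n) : ℝ := ‖(X - Y) * E‖

/-- Partial trace Lyapunov function `2 n̄ - 2 Re tr (E† X̃ E)`. -/
def lyap (E : Matrix (Fin n) (Fin nb) ℂ) (Xt : Mat n) : ℝ :=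
  2 * (nb : ℝ) - 2 * (Matrix.trace (Eᴴ * Xt * E)).re

/-- The closed ball `{Y ∈ U(n) | pdist Y X ≤ c}`. -/
def pball (E : Matrix (Fin n) (Fin nb) ℂ) (X : Mat n) (c : ℝ) : Set (Mat n) :=
  {Y | Y ∈ U n ∧ pdist E Y X ≤ c}

/-- `S̃_k = X̄† S_k X̄`. -/
def errS (sys : QSystem n m) (Xbar : Mat n) (k : Fin m) : Mat n := Xbarᴴ * sys.S k * Xbar

/-- The feedback law `ũ_k = 2 K Re tr (E† S̃_k X̃ E)`. -/
def feedback (sys : QSystem n m) (K : ℝ) (E : Matrix (Fin n) (Fin nb) ℂ) (Xbar Xt : Mat n)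
    (k : Fin m) : ℝ :=
  2 * K * (Matrix.trace (Eᴴ * errS sys Xbar k * Xt * E)).re

/-- `Xt` solves on `[0, τ]` the closed loop error system `X̃' = (∑ ũ_k S̃_k) X̃` along the
reference `Xbar`. -/
def IsClosedLoop (sys : QSystem n m) (K : ℝ) (E : Matrix (Fin n) (Fin nb) ℂ) (τ : ℝ)
    (Xbar Xt : ℝ → Mat n) : Prop :=
  ∀ t ∈ Set.Icc 0 τ, HasDerivWithinAt Xt
    ((∑ k, feedback sys K E (Xbar t) (Xt t) k • errS sys (Xbar t) k) * Xt t) (Set.Icc 0 τ) t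

/-- The reference trajectory `Xbar` on `[0, τ]` with continuous input `u` is `lam`-attractive in
the ball of radius `c` around the identity. -/
structure IsAttractive (sys : QSystem n m) (K : ℝ) (E : Matrix (Fin n) (Fin nb) ℂ) (c lam : ℝ)
    (τ : ℝ) (u : ℝ → Fin m → ℝ) (Xbar : ℝ → Mat n) : Prop where
  lam_pos : 0 < lam
  lam_lt_one : lam < 1
  continuousOn_input : ∀ k, ContinuousOn (fun t => u t k) (Set.Icc 0 τ)
  reference : IsTrajectory sys u τ Xbar
  attract : ∀ Xt : ℝ → Mat n, IsClosedLoop sys K E τ Xbar Xt → Xt 0 ∈ pball E 1 c →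
    lyap E (Xt τ) ≤ lam * lyap E (Xt 0)

/-- The `T`-periodic input with `M` harmonics and coefficients `a`, `b`. -/
def harmonicInput (T : ℝ) {M : ℕ} (a b : Fin m → Fin M → ℝ) (t : ℝ) (k : Fin m) : ℝ :=
  ∑ l : Fin M, (a k l * Real.sin (2 * ((l : ℝ) + 1) * Real.pi * t / T) +
    b k l * Real.cos (2 * ((l : ℝ) + 1) * Real.pi * t / T))

/-- `Xs` minimizes the Frobenius distance to `Xf` among the unitary matrices whose product with
`E` is `exp (ι φ) Xgoal E` for some phase `φ ∈ Φ`. -/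
def IsOptGoalIn (Φ : Set ℝ) (E : Matrix (Fin n) (Fin nb) ℂ) (Xgoal Xf Xs : Mat n) : Prop :=
  let feasible : Set (Mat n) :=
    {Y | Y ∈ U n ∧ ∃ φ ∈ Φ, Y * E = Complex.exp (Complex.I * (φ : ℂ)) • (Xgoal * E)}
  Xs ∈ feasible ∧ ∀ Y ∈ feasible, ‖Xf - Xs‖ ≤ ‖Xf - Y‖

/-- `Xs = optgoal (Xgoal, Xf)`; the phase is either optimized too, or fixed to zero. -/
def IsOptGoal (E : Matrix (Fin n) (Fin nb) ℂ) (Xgoal Xf Xs : Mat n) : Prop :=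
  IsOptGoalIn Set.univ E Xgoal Xf Xs ∨ IsOptGoalIn {0} E Xgoal Xf Xs

/-- The data produced by the algorithm: `u ℓ` is the input `ū^ℓ` and `X ℓ` the trajectory `X^ℓ`
(`ℓ = 0, 1, …`), `Xg j` is the precomputed goal matrix `X_g^j`, and `q ℓ` is the index chosen in
step `ℓ` (`q 0 = 1` being the initialization). -/
structure Execution (n m : ℕ) where
  u : ℕ → ℝ → Fin m → ℝ
  X : ℕ → ℝ → Mat n
  Xg : ℕ → Mat n
  q : ℕ → ℕ

/-- The goal matrix of step `ℓ ≥ 1`. -/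
def Execution.goal (r : Execution n m) (l : ℕ) : Mat n := r.Xg (r.q l)

/-- The reference trajectory `X̄^ℓ (t) = X^ℓ (t) R_{ℓ+1}`, where
`R_{ℓ+1} = (X^ℓ (T_f))† X̄_{goal, ℓ+1}`; it is tracked in step `ℓ + 1`. -/
def Execution.Xbar (r : Execution n m) (Tf : ℝ) (l : ℕ) (t : ℝ) : Mat n :=
  r.X l t * ((r.X l Tf)ᴴ * r.goal (l + 1))

/-- `d_ℓ = pdist (X̄_{goal, ℓ}, X^{ℓ-1} (T_f))`, for `ℓ ≥ 1`. -/
def Execution.d (r : Execution n m) (E : Matrix (Fin n) (Fin nb) ℂ) (Tf : ℝ) (l : ℕ) : ℝ :=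
  pdist E (r.goal l) (r.X (l - 1) Tf)

/-- The precomputed goal matrices: a chain `X_g^0, …, X_g^p` in `U(n)` from `Xf0` to
`optgoal (Xgoal, Xf0)` with consecutive partial distances at most `α`. -/
structure IsGoalChain (E : Matrix (Fin n) (Fin nb) ℂ) (Xgoal : Mat n) (α : ℝ) (p : ℕ)
    (Xf0 : Mat n) (Xg : ℕ → Mat n) : Prop where
  unitary : ∀ j ≤ p, Xg j ∈ U n
  first : Xg 0 = Xf0
  step : ∀ j < p, pdist E (Xg j) (Xg (j + 1)) ≤ α
  last : IsOptGoal E Xgoal Xf0 (Xg p)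

/-- `r` is an execution (never stopped) of the algorithm on `[0, Tf]` with seed input `seed`,
gain `K`, and the switching strategy with `p` goal matrices and parameters `α`, `β`. -/
structure IsExecution (sys : QSystem n m) (K : ℝ) (E : Matrix (Fin n) (Fin nb) ℂ)
    (Xgoal : Mat n) (α β : ℝ) (p : ℕ) (seed : ℝ → Fin m → ℝ) (Tf : ℝ) (r : Execution n m) :
    Prop where
  seed_eq : ∀ t ∈ Set.Icc 0 Tf, r.u 0 t = seed t
  X_init : ∀ l, r.X l 0 = 1
  X_traj : ∀ l, IsTrajectory sys (r.u l) Tf (r.X l)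
  /-- Step `l + 1`: the new input is the closed loop input along the reference `X̄^l`. -/
  input : ∀ l, ∀ t ∈ Set.Icc 0 Tf, ∀ k, r.u (l + 1) t k =
    r.u l t k + feedback sys K E (r.Xbar Tf l t) ((r.Xbar Tf l t)ᴴ * r.X (l + 1) t) k
  goals : IsGoalChain E Xgoal α p (r.X 0 Tf) r.Xg
  q_zero : r.q 0 = 1
  /-- Switching policy. -/
  q_succ : ∀ l, IsGreatest
    {j | j ∈ Set.Icc 1 p ∧ r.q l ≤ j ∧ pdist E (r.Xg j) (r.X l Tf) ≤ β} (r.q (l + 1))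

end RIGA

end

namespace RIGA

variable {n m nb : ℕ}

/-! ### Frobenius norms, traces and unitary matrices -/

/-! On unitary matrices $\mathcal V(\widetilde X)=\|(\widetilde X-1)E\|^2$, and along the closed
loop $\dot{\mathcal V}=-\frac1K\sum_k\widetilde u_k^2$. Hence step $j$ dissipates at most $d_j^2$ in
all, and on an interval of length $L$ the error state moves by at most a constant times
$\sqrt{L\,\Delta\mathcal V}$ (`IsClosedLoop.norm_sub_sq_le`).

The danger is that corrections accumulated over many steps spoil the attractivity of the seed. Cut
$[0,T_f]$ into $N$ windows of length $L$, a multiple of the period. By Cauchy-Schwarz and averaging,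
some window sees all earlier steps with total displacement $O(\sum_j d_j/\sqrt N)$
(`exists_window`). The index $q$ jumps fewer than $p$ times and $d$ contracts by $\rho$ otherwise,
so $\sum_j d_j\le p\beta/(1-\rho)$ (`sum_d_le`), uniformly in the step. For large $N$ the reference
is therefore as close as desired, on that window, to a trajectory of the seed.

Attractivity survives such a perturbation because the perturbation of the closed loop field is
proportional to the tracking error: the contraction factor $\sqrt\lambda$ only degrades to $\rho<1$
(`exists_robust_contraction`). Outside the window $\mathcal V$ does not increase, so $\theta=\rho^2$
works on $[0,T_f]$. The bound on $\sum_j d_j$ uses attractivity at the earlier steps only, so strong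
induction closes the argument (`isAttractive`). Convergence and the input bound then follow from the
contraction, the summability of $d$, and the gap $\beta-\alpha$, which forces switching up to the
last goal. -/

lemma frobenius_norm_sq_eq_trace {ι κ : Type*} [Fintype ι] [Fintype κ] (A : Matrix ι κ ℂ) :
    ‖A‖ ^ 2 = (Matrix.trace (Aᴴ * A)).re := by
  have h0 : 0 ≤ ∑ i, ∑ j, ‖A i j‖ ^ (2 : ℝ) := by positivity
  rw [Matrix.frobenius_norm_def, ← Real.sqrt_eq_rpow, Real.sq_sqrt h0, Finset.sum_comm]
  simp only [Matrix.trace, Matrix.diag, Matrix.mul_apply, Matrix.conjTranspose_apply,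
    Complex.re_sum]
  refine Finset.sum_congr rfl fun j _ => Finset.sum_congr rfl fun i _ => ?_
  rw [Real.rpow_two, ← Complex.normSq_eq_norm_sq, Complex.star_def,
    ← Complex.normSq_eq_conj_mul_self, Complex.ofReal_re]

lemma norm_entry_le_frobenius {ι κ : Type*} [Fintype ι] [Fintype κ] (A : Matrix ι κ ℂ)
    (i : ι) (j : κ) : ‖A i j‖ ≤ ‖A‖ := by
  have h0 : 0 ≤ ∑ i, ∑ j, ‖A i j‖ ^ (2 : ℝ) := by positivity
  have h : ‖A‖ ^ 2 = ∑ i, ∑ j, ‖A i j‖ ^ (2 : ℝ) := by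
    rw [Matrix.frobenius_norm_def, ← Real.sqrt_eq_rpow, Real.sq_sqrt h0]
  refine le_of_sq_le_sq ?_ (norm_nonneg _)
  rw [h]
  calc ‖A i j‖ ^ 2 = ‖A i j‖ ^ (2 : ℝ) := (Real.rpow_two _).symm
    _ ≤ ∑ j, ‖A i j‖ ^ (2 : ℝ) :=
        Finset.single_le_sum (f := fun j => ‖A i j‖ ^ (2 : ℝ)) (fun _ _ => by positivity)
          (Finset.mem_univ j)
    _ ≤ _ := Finset.single_le_sum (f := fun i => ∑ j, ‖A i j‖ ^ (2 : ℝ))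
          (fun _ _ => by positivity) (Finset.mem_univ i)

lemma abs_re_trace_le (A : Mat nb) : |(Matrix.trace A).re| ≤ nb * ‖A‖ := by
  refine (Complex.abs_re_le_norm _).trans ?_
  calc ‖Matrix.trace A‖ ≤ ∑ i, ‖A i i‖ := norm_sum_le _ _
    _ ≤ ∑ _i : Fin nb, ‖A‖ := Finset.sum_le_sum fun i _ => norm_entry_le_frobenius A i i
    _ = nb * ‖A‖ := by simp

lemma conjTranspose_mul_self_of_mem_U {Y : Mat n} (hY : Y ∈ U n) : Yᴴ * Y = 1 :=
  Matrix.mem_unitaryGroup_iff'.1 hY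

lemma mul_conjTranspose_self_of_mem_U {Y : Mat n} (hY : Y ∈ U n) : Y * Yᴴ = 1 :=
  Matrix.mem_unitaryGroup_iff.1 hY

lemma conjTranspose_mem_U {Y : Mat n} (hY : Y ∈ U n) : Yᴴ ∈ U n :=
  Matrix.mem_unitaryGroup_iff.2 (by
    rw [Matrix.star_eq_conjTranspose, Matrix.conjTranspose_conjTranspose]
    exact conjTranspose_mul_self_of_mem_U hY)

lemma mul_mem_U {X Y : Mat n} (hX : X ∈ U n) (hY : Y ∈ U n) : X * Y ∈ U n :=
  (Matrix.unitaryGroup (Fin n) ℂ).mul_mem hX hY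

lemma norm_unitary_mul {Y : Mat n} (hY : Y ∈ U n) {k : ℕ} (A : Matrix (Fin n) (Fin k) ℂ) :
    ‖Y * A‖ = ‖A‖ := by
  have h : ‖Y * A‖ ^ 2 = ‖A‖ ^ 2 := by
    rw [frobenius_norm_sq_eq_trace, frobenius_norm_sq_eq_trace, Matrix.conjTranspose_mul,
      Matrix.mul_assoc, ← Matrix.mul_assoc Yᴴ, conjTranspose_mul_self_of_mem_U hY, Matrix.one_mul]
  exact (pow_left_inj₀ (norm_nonneg _) (norm_nonneg _) two_ne_zero).1 h

lemma norm_mul_unitary {Y : Mat n} (hY : Y ∈ U n) {k : ℕ} (A : Matrix (Fin k) (Fin n) ℂ) :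
    ‖A * Y‖ = ‖A‖ := by
  rw [← Matrix.frobenius_norm_conjTranspose, Matrix.conjTranspose_mul,
    norm_unitary_mul (conjTranspose_mem_U hY), Matrix.frobenius_norm_conjTranspose]

lemma norm_eq_of_mem_U {Y : Mat n} (hY : Y ∈ U n) : ‖Y‖ = ‖(1 : Mat n)‖ := by
  simpa using norm_unitary_mul hY (1 : Mat n)

/-- Unitarity reduces $(Z-1)^\dagger(Z-1)$ to $2-Z-Z^\dagger$, and orthonormality of the columns
makes the constant term $2\bar n$. This converts decay of the Lyapunov function into decay of the
partial distance. -/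
lemma lyap_eq_norm_sq {E : Matrix (Fin n) (Fin nb) ℂ} (hE : Eᴴ * E = 1) {Z : Mat n}
    (hZ : Z ∈ U n) : lyap E Z = ‖(Z - 1) * E‖ ^ 2 := by
  have h1 : ((Z - 1) * E)ᴴ * ((Z - 1) * E) =
      (1 : Mat nb) + 1 - (Eᴴ * Z * E)ᴴ - Eᴴ * Z * E := by
    have h2 : (Z - 1)ᴴ * (Z - 1) = 1 + 1 - Zᴴ - Z := by
      rw [Matrix.conjTranspose_sub, Matrix.conjTranspose_one, sub_mul, mul_sub, mul_sub,
        conjTranspose_mul_self_of_mem_U hZ]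
      simp only [mul_one, one_mul]
      abel
    calc ((Z - 1) * E)ᴴ * ((Z - 1) * E) = Eᴴ * ((Z - 1)ᴴ * (Z - 1)) * E := by
          simp only [Matrix.conjTranspose_mul, Matrix.mul_assoc]
      _ = Eᴴ * E + Eᴴ * E - Eᴴ * Zᴴ * E - Eᴴ * Z * E := by
          rw [h2]
          simp only [Matrix.mul_sub, Matrix.sub_mul, Matrix.mul_add, Matrix.add_mul,
            Matrix.mul_one]
      _ = _ := by
          rw [hE]
          simp only [Matrix.conjTranspose_mul, Matrix.conjTranspose_conjTranspose,
            Matrix.mul_assoc]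
  rw [frobenius_norm_sq_eq_trace, h1, lyap]
  simp only [Matrix.trace_sub, Matrix.trace_add, Matrix.trace_one, Fintype.card_fin,
    Matrix.trace_conjTranspose, Complex.sub_re, Complex.add_re, Complex.natCast_re,
    Complex.star_def, Complex.conj_re]
  ring

lemma lyap_eq_pdist_sq {E : Matrix (Fin n) (Fin nb) ℂ} (hE : Eᴴ * E = 1) {Z : Mat n}
    (hZ : Z ∈ U n) : lyap E Z = pdist E Z 1 ^ 2 := lyap_eq_norm_sq hE hZ

lemma pdist_comm (E : Matrix (Fin n) (Fin nb) ℂ) (X Y : Mat n) : pdist E X Y = pdist E Y X := by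
  rw [pdist, pdist, ← neg_sub Y X, Matrix.neg_mul, norm_neg]

lemma pdist_nonneg (E : Matrix (Fin n) (Fin nb) ℂ) (X Y : Mat n) : 0 ≤ pdist E X Y :=
  norm_nonneg _

lemma pdist_triangle (E : Matrix (Fin n) (Fin nb) ℂ) (X Y Z : Mat n) :
    pdist E X Z ≤ pdist E X Y + pdist E Y Z := by
  have h : (X - Z) * E = (X - Y) * E + (Y - Z) * E := by
    rw [← Matrix.add_mul, sub_add_sub_cancel]
  rw [pdist, h]
  exact norm_add_le _ _

lemma pdist_unitary_mul {W : Mat n} (hW : W ∈ U n) (E : Matrix (Fin n) (Fin nb) ℂ)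
    (X Y : Mat n) : pdist E (W * X) (W * Y) = pdist E X Y := by
  rw [pdist, ← Matrix.mul_sub, Matrix.mul_assoc, norm_unitary_mul hW, pdist]

/-! ### Skew-Hermitian generators -/

lemma QSystem.conjTranspose_S0 (sys : QSystem n m) : sys.S0ᴴ = -sys.S0 := by
  rw [QSystem.S0, Matrix.conjTranspose_smul, sys.isHermitian_H0]
  simp

lemma QSystem.conjTranspose_S (sys : QSystem n m) (k : Fin m) : (sys.S k)ᴴ = -sys.S k := by
  rw [QSystem.S, Matrix.conjTranspose_smul, sys.isHermitian_H k]
  simp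

lemma QSystem.conjTranspose_gen (sys : QSystem n m) (v : Fin m → ℝ) :
    (sys.gen v)ᴴ = -sys.gen v := by
  simp only [QSystem.gen, Matrix.conjTranspose_add, Matrix.conjTranspose_sum,
    Matrix.conjTranspose_smul, sys.conjTranspose_S0, sys.conjTranspose_S, star_trivial, smul_neg,
    Finset.sum_neg_distrib]
  abel

lemma conjTranspose_errS (sys : QSystem n m) (Y : Mat n) (k : Fin m) :
    (errS sys Y k)ᴴ = -errS sys Y k := by
  simp only [errS, Matrix.conjTranspose_mul, Matrix.conjTranspose_conjTranspose,
    sys.conjTranspose_S, Matrix.neg_mul, Matrix.mul_neg, Matrix.mul_assoc]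

lemma conjTranspose_sum_smul_errS (sys : QSystem n m) (Y : Mat n) (v : Fin m → ℝ) :
    (∑ k, v k • errS sys Y k)ᴴ = -∑ k, v k • errS sys Y k := by
  simp only [Matrix.conjTranspose_sum, Matrix.conjTranspose_smul, conjTranspose_errS, star_trivial,
    smul_neg, Finset.sum_neg_distrib]

/-! ### Estimates for the feedback law -/

lemma norm_errS {Y : Mat n} (hY : Y ∈ U n) (sys : QSystem n m) (k : Fin m) :
    ‖errS sys Y k‖ = ‖sys.S k‖ := by
  rw [errS, norm_mul_unitary hY, norm_unitary_mul (conjTranspose_mem_U hY)]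

lemma norm_errS_sub_le {Y Y' : Mat n} (hY : Y ∈ U n) (hY' : Y' ∈ U n) (sys : QSystem n m)
    (k : Fin m) : ‖errS sys Y k - errS sys Y' k‖ ≤ 2 * ‖sys.S k‖ * ‖Y - Y'‖ := by
  have h : errS sys Y k - errS sys Y' k =
      (Y - Y')ᴴ * sys.S k * Y + Y'ᴴ * (sys.S k * (Y - Y')) := by
    simp only [errS, Matrix.conjTranspose_sub, Matrix.sub_mul, Matrix.mul_sub, Matrix.mul_assoc]
    abel
  rw [h]
  refine (norm_add_le _ _).trans ?_
  rw [norm_mul_unitary hY, norm_unitary_mul (conjTranspose_mem_U hY')]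
  have h1 := Matrix.frobenius_norm_mul (Y - Y')ᴴ (sys.S k)
  have h2 := Matrix.frobenius_norm_mul (sys.S k) (Y - Y')
  rw [Matrix.frobenius_norm_conjTranspose] at h1
  linarith

lemma abs_two_mul_re_trace_le {K : ℝ} (hK : 0 < K) (E : Matrix (Fin n) (Fin nb) ℂ) (A : Mat n)
    (W : Matrix (Fin n) (Fin nb) ℂ) :
    |2 * K * (Matrix.trace (Eᴴ * A * W)).re| ≤ 2 * K * nb * ‖E‖ * ‖A‖ * ‖W‖ := by
  rw [abs_mul, abs_of_pos (by positivity : 0 < 2 * K)]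
  have h1 := abs_re_trace_le (Eᴴ * A * W)
  have h2 : ‖Eᴴ * A * W‖ ≤ ‖E‖ * ‖A‖ * ‖W‖ := by
    refine (Matrix.frobenius_norm_mul _ _).trans ?_
    gcongr
    refine (Matrix.frobenius_norm_mul _ _).trans ?_
    rw [Matrix.frobenius_norm_conjTranspose]
  calc 2 * K * |(Matrix.trace (Eᴴ * A * W)).re| ≤ 2 * K * (nb * (‖E‖ * ‖A‖ * ‖W‖)) := by
        gcongr
        exact h1.trans (by gcongr)
    _ = _ := by ring

/-- As `E† S̃_k E` is skew-Hermitian, only `X̃ - 1` contributes to the feedback. -/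
lemma feedback_eq_sub_one (sys : QSystem n m) (K : ℝ) (E : Matrix (Fin n) (Fin nb) ℂ)
    (Y Z : Mat n) (k : Fin m) :
    feedback sys K E Y Z k =
      2 * K * (Matrix.trace (Eᴴ * errS sys Y k * ((Z - 1) * E))).re := by
  have h : (Matrix.trace (Eᴴ * errS sys Y k * E)).re = 0 := by
    have h1 : (Eᴴ * errS sys Y k * E)ᴴ = -(Eᴴ * errS sys Y k * E) := by
      simp only [Matrix.conjTranspose_mul, Matrix.conjTranspose_conjTranspose,
        conjTranspose_errS, Matrix.neg_mul, Matrix.mul_neg, Matrix.mul_assoc]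
    have h2 := congrArg (fun A => (Matrix.trace A).re) h1
    simp only [Matrix.trace_conjTranspose, Matrix.trace_neg, Complex.neg_re, Complex.star_def,
      Complex.conj_re] at h2
    linarith
  rw [Matrix.sub_mul, Matrix.mul_sub, Matrix.trace_sub, Complex.sub_re, Matrix.one_mul, h,
    sub_zero, feedback]
  simp only [Matrix.mul_assoc]

lemma abs_feedback_le {K : ℝ} (hK : 0 < K) (sys : QSystem n m) (E : Matrix (Fin n) (Fin nb) ℂ)
    {Y : Mat n} (hY : Y ∈ U n) (Z : Mat n) (k : Fin m) :
    |feedback sys K E Y Z k| ≤ 2 * K * nb * ‖E‖ * ‖sys.S k‖ * ‖(Z - 1) * E‖ := by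
  rw [feedback_eq_sub_one, ← norm_errS hY sys k]
  exact abs_two_mul_re_trace_le hK E _ _

lemma abs_feedback_sub_reference_le {K : ℝ} (hK : 0 < K) (sys : QSystem n m)
    (E : Matrix (Fin n) (Fin nb) ℂ) {Y Y' : Mat n} (hY : Y ∈ U n) (hY' : Y' ∈ U n) (Z : Mat n)
    (k : Fin m) :
    |feedback sys K E Y Z k - feedback sys K E Y' Z k| ≤
      2 * K * nb * ‖E‖ * (2 * ‖sys.S k‖ * ‖Y - Y'‖) * ‖(Z - 1) * E‖ := by
  rw [feedback_eq_sub_one, feedback_eq_sub_one, ← mul_sub, ← Complex.sub_re, ← Matrix.trace_sub,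
    ← Matrix.sub_mul, ← Matrix.mul_sub]
  refine (abs_two_mul_re_trace_le hK E _ _).trans ?_
  gcongr
  exact norm_errS_sub_le hY hY' sys k

lemma abs_feedback_sub_state_le {K : ℝ} (hK : 0 < K) (sys : QSystem n m)
    (E : Matrix (Fin n) (Fin nb) ℂ) {Y : Mat n} (hY : Y ∈ U n) (Z Z' : Mat n) (k : Fin m) :
    |feedback sys K E Y Z k - feedback sys K E Y Z' k| ≤
      2 * K * nb * ‖E‖ * ‖sys.S k‖ * (‖E‖ * ‖Z - Z'‖) := by
  have h : feedback sys K E Y Z k - feedback sys K E Y Z' k =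
      2 * K * (Matrix.trace (Eᴴ * errS sys Y k * ((Z - Z') * E))).re := by
    rw [feedback, feedback, ← mul_sub, ← Complex.sub_re, ← Matrix.trace_sub]
    simp only [Matrix.sub_mul, Matrix.mul_sub, Matrix.mul_assoc]
  rw [h]
  refine (abs_two_mul_re_trace_le hK E _ _).trans ?_
  rw [norm_errS hY]
  gcongr
  rw [mul_comm]
  exact Matrix.frobenius_norm_mul _ _

lemma feedback_zero (sys : QSystem n m) (K : ℝ) (E : Matrix (Fin n) (Fin nb) ℂ) (Y : Mat n)
    (k : Fin m) : feedback sys K E Y 0 k = 0 := by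
  simp [feedback]

/-- The right-hand side of the closed loop error system. -/
noncomputable def closedLoopField (sys : QSystem n m) (K : ℝ) (E : Matrix (Fin n) (Fin nb) ℂ)
    (Y Z : Mat n) : Mat n :=
  (∑ k, feedback sys K E Y Z k • errS sys Y k) * Z

lemma closedLoopField_eq_sum (sys : QSystem n m) (K : ℝ) (E : Matrix (Fin n) (Fin nb) ℂ)
    (Y Z : Mat n) :
    closedLoopField sys K E Y Z = ∑ k, feedback sys K E Y Z k • (errS sys Y k * Z) := by
  simp only [closedLoopField, Finset.sum_mul, Matrix.smul_mul]

/-- The factor $\|(Z-1)E\|$ is essential: changing the reference costs only in proportion to the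
tracking error, so a contraction can survive for arbitrarily small errors. -/
lemma norm_closedLoopField_sub_reference_le {K : ℝ} (hK : 0 < K) (sys : QSystem n m)
    (E : Matrix (Fin n) (Fin nb) ℂ) {Y Y' Z : Mat n} (hY : Y ∈ U n) (hY' : Y' ∈ U n)
    (hZ : Z ∈ U n) :
    ‖closedLoopField sys K E Y Z - closedLoopField sys K E Y' Z‖ ≤
      (8 * K * nb * ‖E‖ * ∑ k, ‖sys.S k‖ ^ 2) * ‖Y - Y'‖ * ‖(Z - 1) * E‖ := by
  rw [closedLoopField_eq_sum, closedLoopField_eq_sum, ← Finset.sum_sub_distrib, Finset.mul_sum,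
    Finset.sum_mul, Finset.sum_mul]
  refine (norm_sum_le _ _).trans (Finset.sum_le_sum fun k _ => ?_)
  have h : feedback sys K E Y Z k • (errS sys Y k * Z) -
      feedback sys K E Y' Z k • (errS sys Y' k * Z) =
      (feedback sys K E Y Z k - feedback sys K E Y' Z k) • (errS sys Y k * Z) +
        feedback sys K E Y' Z k • ((errS sys Y k - errS sys Y' k) * Z) := by
    rw [sub_smul, Matrix.sub_mul, smul_sub]
    abel
  rw [h]
  refine (norm_add_le _ _).trans ?_
  rw [norm_smul, norm_smul, norm_mul_unitary hZ, norm_mul_unitary hZ, norm_errS hY,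
    Real.norm_eq_abs, Real.norm_eq_abs]
  have h1 := abs_feedback_sub_reference_le hK sys E hY hY' Z k
  have h2 := abs_feedback_le hK sys E hY' Z k
  have h3 := norm_errS_sub_le hY hY' sys k
  calc _ ≤ 2 * K * nb * ‖E‖ * (2 * ‖sys.S k‖ * ‖Y - Y'‖) * ‖(Z - 1) * E‖ * ‖sys.S k‖ +
        2 * K * nb * ‖E‖ * ‖sys.S k‖ * ‖(Z - 1) * E‖ * (2 * ‖sys.S k‖ * ‖Y - Y'‖) := by
        gcongr
    _ = _ := by ring

/-- The states need only be bounded, not unitary, because the estimate also serves the truncated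
field in the existence proof. -/
lemma norm_closedLoopField_sub_state_le {K : ℝ} (hK : 0 < K) (sys : QSystem n m)
    (E : Matrix (Fin n) (Fin nb) ℂ) {Y Z Z' : Mat n} (hY : Y ∈ U n) {κ : ℝ}
    (hZ : ‖Z‖ ≤ κ) (hZ' : ‖Z'‖ ≤ κ) :
    ‖closedLoopField sys K E Y Z - closedLoopField sys K E Y Z'‖ ≤
      (4 * K * nb * ‖E‖ ^ 2 * κ * ∑ k, ‖sys.S k‖ ^ 2) * ‖Z - Z'‖ := by
  rw [closedLoopField_eq_sum, closedLoopField_eq_sum, ← Finset.sum_sub_distrib, Finset.mul_sum,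
    Finset.sum_mul]
  refine (norm_sum_le _ _).trans (Finset.sum_le_sum fun k _ => ?_)
  have hκ : 0 ≤ κ := (norm_nonneg _).trans hZ
  have h : feedback sys K E Y Z k • (errS sys Y k * Z) -
      feedback sys K E Y Z' k • (errS sys Y k * Z') =
      (feedback sys K E Y Z k - feedback sys K E Y Z' k) • (errS sys Y k * Z) +
        feedback sys K E Y Z' k • (errS sys Y k * (Z - Z')) := by
    rw [sub_smul, Matrix.mul_sub, smul_sub]
    abel
  rw [h]
  refine (norm_add_le _ _).trans ?_
  rw [norm_smul, norm_smul, Real.norm_eq_abs, Real.norm_eq_abs]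
  have h1 := abs_feedback_sub_state_le hK sys E hY Z Z' k
  have h2 := abs_feedback_sub_state_le hK sys E hY Z' 0 k
  rw [feedback_zero, sub_zero, sub_zero] at h2
  have h3 : ‖errS sys Y k * Z‖ ≤ ‖sys.S k‖ * κ := by
    refine (Matrix.frobenius_norm_mul _ _).trans ?_
    rw [norm_errS hY]
    gcongr
  have h4 : ‖errS sys Y k * (Z - Z')‖ ≤ ‖sys.S k‖ * ‖Z - Z'‖ := by
    refine (Matrix.frobenius_norm_mul _ _).trans ?_
    rw [norm_errS hY]
  calc _ ≤ 2 * K * nb * ‖E‖ * ‖sys.S k‖ * (‖E‖ * ‖Z - Z'‖) * (‖sys.S k‖ * κ) +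
        2 * K * nb * ‖E‖ * ‖sys.S k‖ * (‖E‖ * κ) * (‖sys.S k‖ * ‖Z - Z'‖) := by
        gcongr
        exact h2.trans (by gcongr)
    _ = _ := by ring

/-! ### Differential calculus on intervals -/

lemma hasDerivWithinAt_Ici_of_Icc {F : Type*} [NormedAddCommGroup F] [NormedSpace ℝ F]
    {f : ℝ → F} {f' : F} {a b t : ℝ} (ht : t ∈ Set.Ico a b)
    (h : HasDerivWithinAt f f' (Set.Icc a b) t) : HasDerivWithinAt f f' (Set.Ici t) t := by
  have h1 : HasDerivWithinAt f f' (Set.Icc t b) t := h.mono (Set.Icc_subset_Icc_left ht.1)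
  exact h1.mono_of_mem_nhdsWithin (Icc_mem_nhdsGE ht.2)

lemma hasDerivWithinAt_shift {F : Type*} [NormedAddCommGroup F] [NormedSpace ℝ F]
    {f : ℝ → F} {f' : F} {s τ b t : ℝ} (hs : 0 ≤ s) (hb : s + τ ≤ b)
    (h : HasDerivWithinAt f f' (Set.Icc 0 b) (s + t)) :
    HasDerivWithinAt (fun t => f (s + t)) f' (Set.Icc 0 τ) t := by
  have h1 : HasDerivWithinAt (fun t : ℝ => s + t) 1 (Set.Icc 0 τ) t :=
    (hasDerivAt_id t).const_add s |>.hasDerivWithinAt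
  have h2 : Set.MapsTo (fun t : ℝ => s + t) (Set.Icc 0 τ) (Set.Icc 0 b) := fun x hx =>
    ⟨by linarith [hx.1], by linarith [hx.2]⟩
  have h3 := HasDerivWithinAt.scomp t h h1 h2
  rwa [one_smul] at h3

/-- If `‖f'‖² ≤ -C g'`, the displacement of `f` is controlled by the decrease of `g`. -/
lemma norm_sub_sq_le_of_energy {F : Type*} [NormedAddCommGroup F] [NormedSpace ℝ F]
    {f f' : ℝ → F} {g g' : ℝ → ℝ} {a b C : ℝ} (hab : a < b)
    (hf : ∀ t ∈ Set.Icc a b, HasDerivWithinAt f (f' t) (Set.Icc a b) t)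
    (hg : ∀ t ∈ Set.Icc a b, HasDerivWithinAt g (g' t) (Set.Icc a b) t)
    (h : ∀ t ∈ Set.Icc a b, ‖f' t‖ ^ 2 ≤ -(C * g' t)) :
    ‖f b - f a‖ ^ 2 ≤ C * (b - a) * (g a - g b) := by
  -- Young's inequality $\|f'\|\le\eta/2+\|f'\|^2/(2\eta)$ bounds the speed by the derivative of an
  -- explicit function. The mean value inequality then replaces Cauchy-Schwarz for integrals, and no
  -- integrability of $f'$ is needed.
  have key : ∀ η : ℝ, 0 < η →
      ‖f b - f a‖ ≤ η / 2 * (b - a) + C / (2 * η) * (g a - g b) := by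
    intro η hη
    have hB : ∀ t ∈ Set.Icc a b, HasDerivWithinAt
        (fun t => η / 2 * (t - a) + C / (2 * η) * (g a - g t))
        (η / 2 * 1 + C / (2 * η) * (-(g' t))) (Set.Icc a b) t := fun t ht =>
      (((hasDerivWithinAt_id t _).sub_const a).const_mul _).add
        (((hg t ht).const_sub (g a)).const_mul _)
    refine image_norm_le_of_norm_deriv_right_le_deriv_boundary'
      (f := fun t => f t - f a) (f' := f')
      (fun t ht => ((hf t ht).sub_const _).continuousWithinAt)
      (fun t ht => hasDerivWithinAt_Ici_of_Icc ht
        ((hf t (Set.Ico_subset_Icc_self ht)).sub_const _))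
      (by simp) (fun t ht => (hB t ht).continuousWithinAt)
      (fun t ht => hasDerivWithinAt_Ici_of_Icc ht (hB t (Set.Ico_subset_Icc_self ht)))
      (fun t ht => ?_) (Set.right_mem_Icc.2 hab.le)
    have h1 := h t (Set.Ico_subset_Icc_self ht)
    have h2 : η / 2 * 1 + C / (2 * η) * (-(g' t)) = (η ^ 2 + -(C * g' t)) / (2 * η) := by
      field_simp
    rw [h2, le_div_iff₀ (by positivity)]
    nlinarith [sq_nonneg (‖f' t‖ - η)]
  -- The optimal $\eta=\|f(b)-f(a)\|/(b-a)$ is available only for a nonzero displacement. For zero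
  -- displacement the right-hand side must be shown nonnegative, by taking $\eta$ small.
  rcases (norm_nonneg (f b - f a)).eq_or_lt with h0 | h0
  · rw [← h0]
    by_contra hneg
    push Not at hneg
    have hba : 0 < b - a := sub_pos.2 hab
    have h2 : C * (g a - g b) < 0 := by
      by_contra h3
      push Not at h3
      nlinarith [mul_nonneg h3 hba.le]
    set D := C * (g a - g b) with hD
    obtain ⟨η, hη, hη2⟩ : ∃ η : ℝ, 0 < η ∧ η ^ 2 * (b - a) < -D := by
      refine ⟨√(-D / (2 * (b - a))), Real.sqrt_pos.2 (div_pos (by linarith) (by linarith)), ?_⟩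
      rw [Real.sq_sqrt (div_nonneg (by linarith) (by linarith))]
      have : -D / (2 * (b - a)) * (b - a) = -D / 2 := by field_simp
      rw [this]; linarith
    have h3 := key η hη
    rw [← h0] at h3
    have h4 : η / 2 * (b - a) + C / (2 * η) * (g a - g b) = (η ^ 2 * (b - a) + D) / (2 * η) := by
      rw [hD]; field_simp
    rw [h4] at h3
    have h5 : (η ^ 2 * (b - a) + D) / (2 * η) < 0 := div_neg_of_neg_of_pos (by linarith)
      (by positivity)
    linarith
  · have hba : 0 < b - a := sub_pos.2 hab
    set x := ‖f b - f a‖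
    have h1 := key (x / (b - a)) (div_pos h0 hba)
    have h2 : x / (b - a) / 2 * (b - a) + C / (2 * (x / (b - a))) * (g a - g b) =
        (x ^ 2 + C * (b - a) * (g a - g b)) / (2 * x) := by
      field_simp
    rw [h2, le_div_iff₀ (by positivity)] at h1
    nlinarith

/-- Flows of skew-Hermitian generators preserve the unitary group. -/
lemma mem_U_of_hasDerivWithinAt_skew {A X : ℝ → Mat n} {τ : ℝ} (h0 : X 0 ∈ U n)
    (hA : ∀ t ∈ Set.Icc 0 τ, (A t)ᴴ = -A t)
    (hX : ∀ t ∈ Set.Icc 0 τ, HasDerivWithinAt X (A t * X t) (Set.Icc 0 τ) t) :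
    ∀ t ∈ Set.Icc 0 τ, X t ∈ U n := by
  have hd : ∀ t ∈ Set.Icc 0 τ, HasDerivWithinAt (fun t => (X t)ᴴ * X t) 0 (Set.Icc 0 τ) t := by
    intro t ht
    have h1 := ((hX t ht).star).mul (hX t ht)
    refine h1.congr_deriv ?_
    simp only [Matrix.star_eq_conjTranspose, Matrix.conjTranspose_mul, hA t ht]
    simp only [Matrix.mul_neg, Matrix.neg_mul, Matrix.mul_assoc, neg_add_cancel]
  intro t ht
  have h2 := constant_of_has_deriv_right_zero (fun t ht => (hd t ht).continuousWithinAt)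
    (fun t ht => hasDerivWithinAt_Ici_of_Icc ht (hd t (Set.Ico_subset_Icc_self ht))) t ht
  refine Matrix.mem_unitaryGroup_iff'.2 ?_
  rw [Matrix.star_eq_conjTranspose]
  exact h2.trans (conjTranspose_mul_self_of_mem_U h0)

lemma IsTrajectory.mem_U {sys : QSystem n m} {u : ℝ → Fin m → ℝ} {τ : ℝ} {X : ℝ → Mat n}
    (h : IsTrajectory sys u τ X) : ∀ t ∈ Set.Icc 0 τ, X t ∈ U n :=
  mem_U_of_hasDerivWithinAt_skew h.init (fun _ _ => sys.conjTranspose_gen _) h.deriv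

lemma IsTrajectory.continuousOn {sys : QSystem n m} {u : ℝ → Fin m → ℝ} {τ : ℝ} {X : ℝ → Mat n}
    (h : IsTrajectory sys u τ X) : ContinuousOn X (Set.Icc 0 τ) :=
  fun t ht => (h.deriv t ht).continuousWithinAt

lemma IsTrajectory.mul_const {sys : QSystem n m} {u : ℝ → Fin m → ℝ} {τ : ℝ} {X : ℝ → Mat n}
    (h : IsTrajectory sys u τ X) {R : Mat n} (hR : R ∈ U n) :
    IsTrajectory sys u τ (fun t => X t * R) where
  init := mul_mem_U h.init hR
  deriv t ht := by
    rw [← Matrix.mul_assoc]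
    exact (h.deriv t ht).mul_const R

lemma IsTrajectory.congr_input {sys : QSystem n m} {u v : ℝ → Fin m → ℝ} {τ : ℝ}
    {X : ℝ → Mat n} (h : IsTrajectory sys u τ X) (huv : ∀ t ∈ Set.Icc 0 τ, u t = v t) :
    IsTrajectory sys v τ X where
  init := h.init
  deriv t ht := by
    rw [← huv t ht]
    exact h.deriv t ht

lemma IsTrajectory.shift {sys : QSystem n m} {u : ℝ → Fin m → ℝ} {s τ b : ℝ} {X : ℝ → Mat n}
    (h : IsTrajectory sys u b X) (hs : 0 ≤ s) (hτ : 0 ≤ τ) (hb : s + τ ≤ b) :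
    IsTrajectory sys (fun t => u (s + t)) τ (fun t => X (s + t)) where
  init := h.mem_U _ ⟨by linarith, by linarith⟩
  deriv t ht := hasDerivWithinAt_shift hs hb
    (h.deriv (s + t) ⟨by linarith [ht.1], by linarith [ht.2]⟩)

/-! ### The closed loop -/

section ClosedLoop

variable {sys : QSystem n m} {K : ℝ} {E : Matrix (Fin n) (Fin nb) ℂ} {τ : ℝ} {Y Z : ℝ → Mat n}

lemma IsClosedLoop.mem_U (h : IsClosedLoop sys K E τ Y Z) (h0 : Z 0 ∈ U n) :
    ∀ t ∈ Set.Icc 0 τ, Z t ∈ U n :=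
  mem_U_of_hasDerivWithinAt_skew h0 (fun _ _ => conjTranspose_sum_smul_errS sys _ _) h

lemma IsClosedLoop.shift {s b : ℝ} (h : IsClosedLoop sys K E b Y Z) (hs : 0 ≤ s)
    (hb : s + τ ≤ b) : IsClosedLoop sys K E τ (fun t => Y (s + t)) (fun t => Z (s + t)) :=
  fun t ht => hasDerivWithinAt_shift hs hb
    (h (s + t) ⟨by linarith [ht.1], by linarith [ht.2]⟩)

lemma hasDerivWithinAt_lyap {E : Matrix (Fin n) (Fin nb) ℂ} {Z : ℝ → Mat n} {Z' : Mat n}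
    {s : Set ℝ} {t : ℝ} (h : HasDerivWithinAt Z Z' s t) :
    HasDerivWithinAt (fun t => lyap E (Z t)) (-(2 * (Matrix.trace (Eᴴ * Z' * E)).re)) s t := by
  let L : Mat n →ₗ[ℝ] ℝ :=
    { toFun := fun A => (Matrix.trace (Eᴴ * A * E)).re
      map_add' := fun A B => by
        rw [Matrix.mul_add, Matrix.add_mul, Matrix.trace_add, Complex.add_re]
      map_smul' := fun c A => by
        rw [Matrix.mul_smul, Matrix.smul_mul, Matrix.trace_smul, Complex.smul_re,
          RingHom.id_apply] }
  have h1 : HasDerivWithinAt (fun t => L (Z t)) (L Z') s t :=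
    (LinearMap.toContinuousLinearMap L).hasFDerivAt.comp_hasDerivWithinAt t h
  exact (h1.const_mul 2).const_sub _

/-- The feedback is $K$ times the descent rate of `lyap` in the direction $\widetilde S_k\widetilde
X$, so each control contributes $-\widetilde u_k^2/K$. -/
lemma IsClosedLoop.hasDerivWithinAt_lyap (h : IsClosedLoop sys K E τ Y Z) (hK : 0 < K) {t : ℝ}
    (ht : t ∈ Set.Icc 0 τ) :
    HasDerivWithinAt (fun t => lyap E (Z t))
      (-(1 / K * ∑ k, feedback sys K E (Y t) (Z t) k ^ 2)) (Set.Icc 0 τ) t := by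
  refine (RIGA.hasDerivWithinAt_lyap (h t ht)).congr_deriv ?_
  congr 1
  rw [Finset.sum_mul, Matrix.mul_sum, Matrix.sum_mul, Matrix.trace_sum, Complex.re_sum,
    Finset.mul_sum, Finset.mul_sum]
  refine Finset.sum_congr rfl fun k _ => ?_
  rw [Matrix.smul_mul, Matrix.mul_smul, Matrix.smul_mul, Matrix.trace_smul, Complex.smul_re,
    ← Matrix.mul_assoc, sq]
  nth_rewrite 3 [feedback]
  rw [smul_eq_mul]
  field_simp

lemma IsClosedLoop.antitoneOn_lyap (h : IsClosedLoop sys K E τ Y Z) (hK : 0 < K) :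
    AntitoneOn (fun t => lyap E (Z t)) (Set.Icc 0 τ) := by
  refine antitoneOn_of_hasDerivWithinAt_nonpos (convex_Icc 0 τ)
    (f' := fun t => -(1 / K * ∑ k, feedback sys K E (Y t) (Z t) k ^ 2))
    (fun t ht => (h.hasDerivWithinAt_lyap hK ht).continuousWithinAt)
    (fun t ht => (h.hasDerivWithinAt_lyap hK (interior_subset ht)).mono interior_subset)
    (fun t _ => ?_)
  have : 0 ≤ ∑ k, feedback sys K E (Y t) (Z t) k ^ 2 := Finset.sum_nonneg fun _ _ => sq_nonneg _
  have h2 : 0 ≤ 1 / K := by positivity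
  nlinarith [mul_nonneg h2 this]

/-- Cauchy-Schwarz over the controls: the squared speed is bounded by a multiple of the dissipation
rate, the hypothesis of `norm_sub_sq_le_of_energy`. -/
lemma norm_closedLoopField_sq_le {Y Z : Mat n} (hY : Y ∈ U n) (hZ : Z ∈ U n) :
    ‖closedLoopField sys K E Y Z‖ ^ 2 ≤
      (∑ k, ‖sys.S k‖ ^ 2) * ∑ k, feedback sys K E Y Z k ^ 2 := by
  have h1 : ‖closedLoopField sys K E Y Z‖ ≤ ∑ k, ‖sys.S k‖ * |feedback sys K E Y Z k| := by
    rw [closedLoopField_eq_sum]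
    refine (norm_sum_le _ _).trans (Finset.sum_le_sum fun k _ => ?_)
    rw [norm_smul, norm_mul_unitary hZ, norm_errS hY, Real.norm_eq_abs, mul_comm]
  calc ‖closedLoopField sys K E Y Z‖ ^ 2
      ≤ (∑ k, ‖sys.S k‖ * |feedback sys K E Y Z k|) ^ 2 := by gcongr
    _ ≤ (∑ k, ‖sys.S k‖ ^ 2) * ∑ k, |feedback sys K E Y Z k| ^ 2 :=
        Finset.sum_mul_sq_le_sq_mul_sq _ _ _
    _ = _ := by simp only [sq_abs]

/-- The displacement of a closed loop solution is bounded by the decrease of `lyap`. -/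
lemma IsClosedLoop.norm_sub_sq_le (h : IsClosedLoop sys K E τ Y Z) (hK : 0 < K)
    (hY : ∀ t ∈ Set.Icc 0 τ, Y t ∈ U n) (h0 : Z 0 ∈ U n) {s t : ℝ} (hs : 0 ≤ s) (hst : s ≤ t)
    (ht : t ≤ τ) :
    ‖Z t - Z s‖ ^ 2 ≤
      (K * ∑ k, ‖sys.S k‖ ^ 2) * (t - s) * (lyap E (Z s) - lyap E (Z t)) := by
  rcases hst.eq_or_lt with rfl | hlt
  · simp
  have hsub : Set.Icc s t ⊆ Set.Icc 0 τ := Set.Icc_subset_Icc hs ht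
  refine norm_sub_sq_le_of_energy (g := fun t => lyap E (Z t))
    (f' := fun t => closedLoopField sys K E (Y t) (Z t))
    (g' := fun t => -(1 / K * ∑ k, feedback sys K E (Y t) (Z t) k ^ 2)) hlt
    (fun r hr => (h r (hsub hr)).mono hsub)
    (fun r hr => (h.hasDerivWithinAt_lyap hK (hsub hr)).mono hsub) (fun r hr => ?_)
  refine (norm_closedLoopField_sq_le (hY r (hsub hr)) (h.mem_U h0 r (hsub hr))).trans_eq ?_
  field_simp

end ClosedLoop

/-! ### Existence of closed loop solutions -/

/-- The radial projection onto the closed ball of radius `ρ`. -/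
noncomputable def radialProj {F : Type*} [NormedAddCommGroup F] [NormedSpace ℝ F] (ρ : ℝ)
    (x : F) : F :=
  (ρ / max ρ ‖x‖) • x

section RadialProj

variable {F : Type*} [NormedAddCommGroup F] [NormedSpace ℝ F] {ρ : ℝ}

lemma radialProj_of_norm_le (hρ : 0 < ρ) {x : F} (hx : ‖x‖ ≤ ρ) : radialProj ρ x = x := by
  rw [radialProj, max_eq_left hx, div_self hρ.ne', one_smul]

lemma norm_radialProj_le (hρ : 0 < ρ) (x : F) : ‖radialProj ρ x‖ ≤ ρ := by
  have hM : 0 < max ρ ‖x‖ := lt_max_of_lt_left hρ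
  rw [radialProj, norm_smul, Real.norm_of_nonneg (by positivity), div_mul_eq_mul_div,
    div_le_iff₀ hM]
  gcongr
  exact le_max_right _ _

lemma norm_radialProj_sub_le (hρ : 0 < ρ) (x y : F) :
    ‖radialProj ρ x - radialProj ρ y‖ ≤ 2 * ‖x - y‖ := by
  have hx : 0 < max ρ ‖x‖ := lt_max_of_lt_left hρ
  have hy : 0 < max ρ ‖y‖ := lt_max_of_lt_left hρ
  have h1 : radialProj ρ x - radialProj ρ y = (ρ / max ρ ‖x‖) • (x - y) +
      ((ρ / max ρ ‖x‖) * ((max ρ ‖y‖ - max ρ ‖x‖) / max ρ ‖y‖)) • y := by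
    have h2 : (ρ / max ρ ‖x‖) * ((max ρ ‖y‖ - max ρ ‖x‖) / max ρ ‖y‖) =
        ρ / max ρ ‖x‖ - ρ / max ρ ‖y‖ := by
      field_simp
    rw [h2, radialProj, radialProj, smul_sub, sub_smul]
    abel
  have h3 : |max ρ ‖y‖ - max ρ ‖x‖| ≤ ‖x - y‖ := by
    refine (abs_max_sub_max_le_max ρ ‖y‖ ρ ‖x‖).trans ?_
    rw [sub_self, abs_zero, max_eq_right (abs_nonneg _), ← norm_sub_rev y x]
    exact abs_norm_sub_norm_le y x
  have h4 : ρ / max ρ ‖x‖ ≤ 1 := (div_le_one hx).2 (le_max_left _ _)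
  have h5 : ‖y‖ / max ρ ‖y‖ ≤ 1 := (div_le_one hy).2 (le_max_right _ _)
  rw [h1]
  refine (norm_add_le _ _).trans ?_
  rw [norm_smul, norm_smul, norm_mul, norm_div (_ - _), Real.norm_of_nonneg hy.le,
    Real.norm_of_nonneg (div_nonneg hρ.le hx.le), Real.norm_eq_abs]
  calc ρ / max ρ ‖x‖ * ‖x - y‖ +
        ρ / max ρ ‖x‖ * (|max ρ ‖y‖ - max ρ ‖x‖| / max ρ ‖y‖) * ‖y‖
      = ρ / max ρ ‖x‖ * (‖x - y‖ + |max ρ ‖y‖ - max ρ ‖x‖| * (‖y‖ / max ρ ‖y‖)) := by ring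
    _ ≤ 1 * (‖x - y‖ + ‖x - y‖ * 1) := by gcongr
    _ = 2 * ‖x - y‖ := by ring

end RadialProj

lemma continuous_closedLoopField_reference (sys : QSystem n m) (K : ℝ)
    (E : Matrix (Fin n) (Fin nb) ℂ) (Z : Mat n) :
    Continuous fun Y => closedLoopField sys K E Y Z := by
  unfold closedLoopField feedback errS
  fun_prop

/-- Attractivity speaks about given solutions, so one along the seed reference must be produced. The
field is quadratic in the state; composed with a radial projection it is bounded and globally
Lipschitz, and Picard-Lindelöf applies on all of $[0,\tau]$. The truncated field is still a
skew-Hermitian matrix times the state, so the solution stays unitary, where the truncation is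
inactive. -/
lemma exists_isClosedLoop {K : ℝ} (hK : 0 < K) (sys : QSystem n m)
    (E : Matrix (Fin n) (Fin nb) ℂ) {τ : ℝ} (hτ : 0 ≤ τ) {Y : ℝ → Mat n}
    (hYc : ContinuousOn Y (Set.Icc 0 τ)) (hY : ∀ t ∈ Set.Icc 0 τ, Y t ∈ U n) {Z₀ : Mat n}
    (hZ₀ : Z₀ ∈ U n) : ∃ Z : ℝ → Mat n, Z 0 = Z₀ ∧ IsClosedLoop sys K E τ Y Z := by
  set κ : ℝ := ‖(1 : Mat n)‖ + 1 with hκ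
  have hκ0 : 0 < κ := by positivity
  set C : ℝ := 4 * K * nb * ‖E‖ ^ 2 * κ * ∑ k, ‖sys.S k‖ ^ 2 with hC
  have hC0 : 0 ≤ C := by positivity
  have hlip : ∀ t ∈ Set.Icc 0 τ, ∀ x y : Mat n,
      ‖closedLoopField sys K E (Y t) (radialProj κ x) -
        closedLoopField sys K E (Y t) (radialProj κ y)‖ ≤ C * 2 * ‖x - y‖ := by
    intro t ht x y
    refine (norm_closedLoopField_sub_state_le hK sys E (hY t ht) (norm_radialProj_le hκ0 x)
      (norm_radialProj_le hκ0 y)).trans ?_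
    rw [← hC, mul_assoc C]
    exact mul_le_mul_of_nonneg_left (norm_radialProj_sub_le hκ0 x y) hC0
  have hbd : ∀ t ∈ Set.Icc 0 τ, ∀ x : Mat n,
      ‖closedLoopField sys K E (Y t) (radialProj κ x)‖ ≤ C * κ := by
    intro t ht x
    have h1 := norm_closedLoopField_sub_state_le hK sys E (hY t ht) (norm_radialProj_le hκ0 x)
      (Z' := 0) (by rw [norm_zero]; exact hκ0.le)
    have h2 : closedLoopField sys K E (Y t) 0 = 0 := by simp [closedLoopField]
    rw [h2, sub_zero, sub_zero] at h1
    exact h1.trans (mul_le_mul_of_nonneg_left (norm_radialProj_le hκ0 x) hC0)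
  have hPL : IsPicardLindelof
      (fun t x => closedLoopField sys K E (Y t) (radialProj κ x))
      (⟨0, Set.left_mem_Icc.2 hτ⟩ : Set.Icc 0 τ) Z₀ (C * κ * τ).toNNReal 0
      (C * κ).toNNReal (C * 2).toNNReal :=
    { lipschitzOnWith := fun t ht => LipschitzOnWith.of_dist_le_mul fun x _ y _ => by
        rw [dist_eq_norm, dist_eq_norm, Real.coe_toNNReal _ (by positivity)]
        exact hlip t ht x y
      continuousOn := fun x _ =>
        (continuous_closedLoopField_reference sys K E _).comp_continuousOn hYc
      norm_le := fun t ht x _ => by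
        rw [Real.coe_toNNReal _ (by positivity)]
        exact hbd t ht x
      mul_max_le := by
        rw [Real.coe_toNNReal _ (by positivity), Real.coe_toNNReal _ (by positivity)]
        simp [hτ] }
  obtain ⟨Z, hZ0, hZ⟩ := hPL.exists_eq_forall_mem_Icc_hasDerivWithinAt₀
  have hU : ∀ t ∈ Set.Icc 0 τ, Z t ∈ U n := by
    refine mem_U_of_hasDerivWithinAt_skew (A := fun t => ∑ k,
      (κ / max κ ‖Z t‖ * feedback sys K E (Y t) (radialProj κ (Z t)) k) • errS sys (Y t) k)
      (by rw [hZ0]; exact hZ₀) (fun t _ => conjTranspose_sum_smul_errS sys _ _) fun t ht => ?_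
    refine (hZ t ht).congr_deriv ?_
    rw [closedLoopField, radialProj, Matrix.mul_smul, ← Matrix.smul_mul, Finset.smul_sum]
    simp only [smul_smul]
  refine ⟨Z, hZ0, fun t ht => ?_⟩
  have h1 : radialProj κ (Z t) = Z t := radialProj_of_norm_le hκ0 (by
    rw [norm_eq_of_mem_U (hU t ht), hκ]; linarith)
  have h2 := hZ t ht
  simp only [h1] at h2
  exact h2

/-! ### Robustness of attractivity -/

/-- Closed loop solutions along nearby references with the same initial condition stay close,
relatively to the initial error. -/
lemma exists_norm_closedLoop_sub_le {K : ℝ} (hK : 0 < K) (sys : QSystem n m)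
    {E : Matrix (Fin n) (Fin nb) ℂ} (hE : Eᴴ * E = 1) {τ : ℝ} (hτ : 0 ≤ τ) :
    ∃ C : ℝ, 0 < C ∧ ∀ (δ : ℝ) (Y Y' Z Z' : ℝ → Mat n),
      (∀ t ∈ Set.Icc 0 τ, Y t ∈ U n) → (∀ t ∈ Set.Icc 0 τ, Y' t ∈ U n) →
      (∀ t ∈ Set.Icc 0 τ, ‖Y t - Y' t‖ ≤ δ) → Z 0 ∈ U n → Z' 0 = Z 0 →
      IsClosedLoop sys K E τ Y Z → IsClosedLoop sys K E τ Y' Z' →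
      ‖Z τ - Z' τ‖ ≤ C * δ * ‖(Z 0 - 1) * E‖ := by
  obtain ⟨A, hA0, hA⟩ : ∃ A : ℝ, 0 ≤ A ∧ ∀ Y Y' Z : Mat n, Y ∈ U n → Y' ∈ U n → Z ∈ U n →
      ‖closedLoopField sys K E Y Z - closedLoopField sys K E Y' Z‖ ≤
        A * ‖Y - Y'‖ * ‖(Z - 1) * E‖ :=
    ⟨_, by positivity, fun _ _ _ hY hY' hZ =>
      norm_closedLoopField_sub_reference_le hK sys E hY hY' hZ⟩
  obtain ⟨B, hB0, hB⟩ : ∃ B : ℝ, 0 < B ∧ ∀ Y Z Z' : Mat n, Y ∈ U n → ‖Z‖ ≤ ‖(1 : Mat n)‖ →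
      ‖Z'‖ ≤ ‖(1 : Mat n)‖ →
      ‖closedLoopField sys K E Y Z - closedLoopField sys K E Y Z'‖ ≤ B * ‖Z - Z'‖ := by
    -- The summand $1$ makes the Lipschitz constant positive, so that the Grönwall bound takes its
    -- exponential form.
    refine ⟨4 * K * nb * ‖E‖ ^ 2 * ‖(1 : Mat n)‖ * ∑ k, ‖sys.S k‖ ^ 2 + 1, by positivity,
      fun Y Z Z' hY hZ hZ' => (norm_closedLoopField_sub_state_le hK sys E hY hZ hZ').trans ?_⟩
    gcongr
    linarith
  refine ⟨A / B * (Real.exp (B * τ) - 1) + 1, ?_, ?_⟩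
  · have : 1 ≤ Real.exp (B * τ) := Real.one_le_exp (by positivity)
    have : 0 ≤ A / B * (Real.exp (B * τ) - 1) := mul_nonneg (by positivity) (by linarith)
    linarith
  intro δ Y Y' Z Z' hY hY' hδ hZ0 hZ'0 hZ hZ'
  have hZU := hZ.mem_U hZ0
  have hZU' := hZ'.mem_U (by rw [hZ'0]; exact hZ0)
  have hδ0 : 0 ≤ δ := (norm_nonneg _).trans (hδ 0 (Set.left_mem_Icc.2 hτ))
  -- Lyapunov decay keeps the tracking error below its initial value, so the forcing term in
  -- Grönwall's inequality is proportional to that value.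
  have hmono : ∀ t ∈ Set.Icc 0 τ, ‖(Z t - 1) * E‖ ≤ ‖(Z 0 - 1) * E‖ := by
    intro t ht
    have h1 := hZ.antitoneOn_lyap hK (Set.left_mem_Icc.2 hτ) ht ht.1
    simp only at h1
    rw [lyap_eq_norm_sq hE (hZU t ht), lyap_eq_norm_sq hE hZ0] at h1
    exact le_of_sq_le_sq h1 (norm_nonneg _)
  have hlip : ∀ t ∈ Set.Ico 0 τ, LipschitzOnWith B.toNNReal
      (fun x => closedLoopField sys K E (Y' t) x) {x : Mat n | ‖x‖ ≤ ‖(1 : Mat n)‖} :=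
    fun t ht => LipschitzOnWith.of_dist_le_mul fun x hx y hy => by
      rw [dist_eq_norm, dist_eq_norm, Real.coe_toNNReal _ hB0.le]
      exact hB _ x y (hY' t (Set.Ico_subset_Icc_self ht)) hx hy
  have herr : ∀ t ∈ Set.Ico 0 τ, dist (closedLoopField sys K E (Y t) (Z t))
      (closedLoopField sys K E (Y' t) (Z t)) ≤ A * δ * ‖(Z 0 - 1) * E‖ := by
    intro t ht
    have ht' := Set.Ico_subset_Icc_self ht
    rw [dist_eq_norm]
    refine (hA _ _ _ (hY t ht') (hY' t ht') (hZU t ht')).trans ?_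
    have h1 := hδ t ht'
    have h2 := hmono t ht'
    gcongr
  have hG := dist_le_of_approx_trajectories_ODE_of_mem (δ := 0) hlip
    (fun t ht => (hZ t ht).continuousWithinAt)
    (fun t ht => hasDerivWithinAt_Ici_of_Icc ht (hZ t (Set.Ico_subset_Icc_self ht))) herr
    (fun t ht => (norm_eq_of_mem_U (hZU t (Set.Ico_subset_Icc_self ht))).le)
    (fun t ht => (hZ' t ht).continuousWithinAt)
    (fun t ht => hasDerivWithinAt_Ici_of_Icc ht (hZ' t (Set.Ico_subset_Icc_self ht)))
    (fun t _ => (dist_self _).le)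
    (fun t ht => (norm_eq_of_mem_U (hZU' t (Set.Ico_subset_Icc_self ht))).le)
    (by rw [hZ'0, dist_self]) τ (Set.right_mem_Icc.2 hτ)
  rw [dist_eq_norm, Real.coe_toNNReal _ hB0.le, gronwallBound_of_K_ne_0 hB0.ne'] at hG
  simp only [zero_mul, zero_add, add_zero, sub_zero] at hG
  refine hG.trans ?_
  have h2 : A * δ * ‖(Z 0 - 1) * E‖ / B * (Real.exp (B * τ) - 1) =
      A / B * (Real.exp (B * τ) - 1) * δ * ‖(Z 0 - 1) * E‖ := by ring
  rw [h2]
  gcongr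
  linarith

/-- If an input is attractive for all initial conditions of the reference, then references close
to one of its trajectories are attractive too, with a contraction factor closer to one. -/
lemma exists_robust_contraction {K : ℝ} (hK : 0 < K) (sys : QSystem n m)
    {E : Matrix (Fin n) (Fin nb) ℂ} (hE : Eᴴ * E = 1) {τ : ℝ} (hτ : 0 ≤ τ) {c lam : ℝ}
    {u : ℝ → Fin m → ℝ}
    (hattr : ∀ Y : ℝ → Mat n, IsTrajectory sys u τ Y → IsAttractive sys K E c lam τ u Y)
    {ρ : ℝ} (hρ : √lam < ρ) :
    ∃ δ : ℝ, 0 < δ ∧ ∀ Y Y' Z : ℝ → Mat n, (∀ t ∈ Set.Icc 0 τ, Y t ∈ U n) →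
      IsTrajectory sys u τ Y' → (∀ t ∈ Set.Icc 0 τ, ‖Y t - Y' t‖ ≤ δ) →
      IsClosedLoop sys K E τ Y Z → Z 0 ∈ pball E 1 c →
      pdist E (Z τ) 1 ≤ ρ * pdist E (Z 0) 1 := by
  obtain ⟨C, hC, hCb⟩ := exists_norm_closedLoop_sub_le hK sys hE hτ
  -- The perturbation may use up the whole gap between $\sqrt\lambda$ and $\rho$; $\|E\|+1$ avoids
  -- division by zero.
  refine ⟨(ρ - √lam) / (C * (‖E‖ + 1)), div_pos (sub_pos.2 hρ) (by positivity), ?_⟩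
  intro Y Y' Z hY hY' hYY' hZ hZ0
  obtain ⟨Z', hZ'0, hZ'⟩ := exists_isClosedLoop hK sys E hτ hY'.continuousOn hY'.mem_U hZ0.1
  have h1 := hCb _ Y Y' Z Z' hY hY'.mem_U hYY' hZ0.1 hZ'0 hZ hZ'
  have hτ' : τ ∈ Set.Icc 0 τ := Set.right_mem_Icc.2 hτ
  have hatt := hattr Y' hY'
  have h2 := hatt.attract Z' hZ' (by rw [hZ'0]; exact hZ0)
  rw [lyap_eq_pdist_sq hE (hZ'.mem_U (by rw [hZ'0]; exact hZ0.1) τ hτ'), hZ'0,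
    lyap_eq_pdist_sq hE hZ0.1, ← Real.sq_sqrt hatt.lam_pos.le, ← mul_pow] at h2
  have h3 : pdist E (Z' τ) 1 ≤ √lam * pdist E (Z 0) 1 :=
    le_of_sq_le_sq h2 (mul_nonneg (Real.sqrt_nonneg _) (pdist_nonneg _ _ _))
  have h4 : pdist E (Z τ) (Z' τ) ≤ (ρ - √lam) * pdist E (Z 0) 1 := by
    refine (Matrix.frobenius_norm_mul _ _).trans ?_
    have hp : 0 ≤ pdist E (Z 0) 1 := pdist_nonneg _ _ _
    have hd : 0 < ρ - √lam := sub_pos.2 hρ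
    calc ‖Z τ - Z' τ‖ * ‖E‖
        ≤ C * ((ρ - √lam) / (C * (‖E‖ + 1))) * pdist E (Z 0) 1 * (‖E‖ + 1) := by
          gcongr
          · exact h1
          · linarith
      _ = (ρ - √lam) * pdist E (Z 0) 1 := by field_simp
  calc pdist E (Z τ) 1 ≤ pdist E (Z τ) (Z' τ) + pdist E (Z' τ) 1 := pdist_triangle _ _ _ _
    _ ≤ ρ * pdist E (Z 0) 1 := by linarith

/-! ### The seed input -/

lemma harmonicInput_periodic {T : ℝ} (hT : 0 < T) {M : ℕ} (a b : Fin m → Fin M → ℝ) (k : ℕ)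
    (t : ℝ) : harmonicInput T a b (k * T + t) = harmonicInput T a b t := by
  funext i
  simp only [harmonicInput]
  refine Finset.sum_congr rfl fun l _ => ?_
  have h : 2 * ((l : ℝ) + 1) * Real.pi * (k * T + t) / T =
      2 * ((l : ℝ) + 1) * Real.pi * t / T + (((l + 1) * k : ℕ) : ℝ) * (2 * Real.pi) := by
    push_cast
    field_simp
    ring
  rw [h, Real.sin_add_nat_mul_two_pi, Real.cos_add_nat_mul_two_pi]

lemma continuous_harmonicInput (T : ℝ) {M : ℕ} (a b : Fin m → Fin M → ℝ) (k : Fin m) :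
    Continuous fun t => harmonicInput T a b t k := by
  unfold harmonicInput
  fun_prop

/-! ### Sequences -/

/-- A nonnegative sequence bounded by `β` which contracts by `ρ` except where the natural number
valued monotone sequence `Q` jumps. -/
lemma sum_le_of_contraction_off_jumps {D : ℕ → ℝ} {Q : ℕ → ℕ} {ρ β : ℝ} (hρ : 0 ≤ ρ)
    (hD0 : ∀ j, 0 ≤ D j) (hDβ : ∀ j, D j ≤ β) (hQ0 : 1 ≤ Q 0) (hQ : Monotone Q) (l : ℕ)
    (hcontr : ∀ j < l, Q (j + 1) = Q j → D (j + 1) ≤ ρ * D j) :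
    (1 - ρ) * ∑ j ∈ Finset.range (l + 1), D j + ρ * D l ≤ Q l * β := by
  have hβ : 0 ≤ β := (hD0 0).trans (hDβ 0)
  -- The term $\rho D_l$ makes the induction work: without a jump it pays for $D_{l+1}\le\rho D_l$,
  -- and at a jump the increase of $Q$ pays for $D_{l+1}\le\beta$.
  induction l with
  | zero =>
    have h1 : (1 : ℝ) ≤ Q 0 := by exact_mod_cast hQ0
    simp only [zero_add, Finset.sum_range_one]
    nlinarith [hDβ 0, mul_le_mul_of_nonneg_right h1 hβ]
  | succ l ih =>
    have h1 := ih fun j hj => hcontr j (hj.trans (Nat.lt_succ_self l))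
    rw [Finset.sum_range_succ]
    rcases (hQ (Nat.le_succ l)).eq_or_lt with h2 | h2
    · have h3 := hcontr l (Nat.lt_succ_self l) h2.symm
      have h4 : (Q (l + 1) : ℝ) = Q l := by exact_mod_cast h2.symm
      rw [h4]
      linarith
    · have h3 : (Q l : ℝ) + 1 ≤ Q (l + 1) := by exact_mod_cast h2
      have h4 := mul_le_mul_of_nonneg_right h3 hβ
      have h5 := mul_nonneg hρ (hD0 l)
      have h6 := hDβ (l + 1)
      linarith

/-- Among `N` windows, one has a small sum of square roots of energies. -/
lemma exists_window_sum_sqrt_le {Δ : ℕ → ℕ → ℝ} {D : ℕ → ℝ} (N l : ℕ) (hN : 0 < N)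
    (hΔ0 : ∀ i < N, ∀ j, 0 ≤ Δ i j) (hD : ∀ j, 0 ≤ D j)
    (hΔ : ∀ j, ∑ i ∈ Finset.range N, Δ i j ≤ D j ^ 2) :
    ∃ i < N, ∑ j ∈ Finset.range l, √(Δ i j) ≤ (∑ j ∈ Finset.range l, D j) / √N := by
  have hN0 : (0 : ℝ) < N := by exact_mod_cast hN
  -- Cauchy-Schwarz over the windows, for each $j$. Summing over $j$ before choosing $i$ yields one
  -- window that is good for all steps together.
  have hcol : ∀ j, ∑ i ∈ Finset.range N, √(Δ i j) ≤ √N * D j := by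
    intro j
    have h1 : (∑ i ∈ Finset.range N, √(Δ i j)) ^ 2 ≤ (√N * D j) ^ 2 := by
      calc (∑ i ∈ Finset.range N, √(Δ i j)) ^ 2
          ≤ (Finset.range N).card * ∑ i ∈ Finset.range N, √(Δ i j) ^ 2 :=
            sq_sum_le_card_mul_sum_sq
        _ = N * ∑ i ∈ Finset.range N, Δ i j := by
            rw [Finset.card_range]
            congr 1
            exact Finset.sum_congr rfl fun i hi =>
              Real.sq_sqrt (hΔ0 i (Finset.mem_range.1 hi) j)
        _ ≤ N * D j ^ 2 := mul_le_mul_of_nonneg_left (hΔ j) hN0.le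
        _ = (√N * D j) ^ 2 := by rw [mul_pow, Real.sq_sqrt hN0.le]
    exact le_of_sq_le_sq h1 (mul_nonneg (Real.sqrt_nonneg _) (hD j))
  have hsum : ∑ i ∈ Finset.range N, ∑ j ∈ Finset.range l, √(Δ i j) ≤
      ∑ _i ∈ Finset.range N, (∑ j ∈ Finset.range l, D j) / √N := by
    rw [Finset.sum_comm, Finset.sum_const, Finset.card_range, nsmul_eq_mul]
    calc ∑ j ∈ Finset.range l, ∑ i ∈ Finset.range N, √(Δ i j)
        ≤ ∑ j ∈ Finset.range l, √N * D j := Finset.sum_le_sum fun j _ => hcol j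
      _ = √N * ∑ j ∈ Finset.range l, D j := (Finset.mul_sum _ _ _).symm
      _ = √N * √N * ((∑ j ∈ Finset.range l, D j) / √N) := by
          have : √(N : ℝ) ≠ 0 := (Real.sqrt_pos.2 hN0).ne'
          field_simp
      _ = N * ((∑ j ∈ Finset.range l, D j) / √N) := by rw [Real.mul_self_sqrt hN0.le]
  obtain ⟨i, hi, hle⟩ := Finset.exists_le_of_sum_le
    (Finset.nonempty_range_iff.2 hN.ne') hsum
  exact ⟨i, Finset.mem_range.1 hi, hle⟩

/-! ### Executions of the algorithm -/

/-- The error state `X̃^{ℓ+1} = (X̄^ℓ)† X^{ℓ+1}`. -/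
noncomputable def Execution.err (r : Execution n m) (Tf : ℝ) (l : ℕ) (t : ℝ) : Mat n :=
  (r.Xbar Tf l t)ᴴ * r.X (l + 1) t

namespace IsExecution

variable {sys : QSystem n m} {K : ℝ} {E : Matrix (Fin n) (Fin nb) ℂ} {Xgoal : Mat n} {α β : ℝ}
  {p : ℕ} {seed : ℝ → Fin m → ℝ} {Tf : ℝ} {r : Execution n m}

lemma monotone_q (h : IsExecution sys K E Xgoal α β p seed Tf r) : Monotone r.q :=
  monotone_nat_of_le_succ fun l => (h.q_succ l).1.2.1

lemma one_le_q (h : IsExecution sys K E Xgoal α β p seed Tf r) (l : ℕ) : 1 ≤ r.q (l + 1) :=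
  (h.q_succ l).1.1.1

lemma q_le (h : IsExecution sys K E Xgoal α β p seed Tf r) (l : ℕ) : r.q (l + 1) ≤ p :=
  (h.q_succ l).1.1.2

lemma goal_mem_U (h : IsExecution sys K E Xgoal α β p seed Tf r) (l : ℕ) :
    r.goal (l + 1) ∈ U n :=
  h.goals.unitary _ (h.q_le l)

lemma X_mem_U (h : IsExecution sys K E Xgoal α β p seed Tf r) (l : ℕ) {t : ℝ}
    (ht : t ∈ Set.Icc 0 Tf) : r.X l t ∈ U n :=
  (h.X_traj l).mem_U t ht

lemma isTrajectory_Xbar (h : IsExecution sys K E Xgoal α β p seed Tf r) (hTf : 0 ≤ Tf) (l : ℕ) :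
    IsTrajectory sys (r.u l) Tf (r.Xbar Tf l) :=
  (h.X_traj l).mul_const (mul_mem_U
    (conjTranspose_mem_U (h.X_mem_U l (Set.right_mem_Icc.2 hTf))) (h.goal_mem_U l))

lemma err_mem_U (h : IsExecution sys K E Xgoal α β p seed Tf r) (hTf : 0 ≤ Tf) (l : ℕ) {t : ℝ}
    (ht : t ∈ Set.Icc 0 Tf) : r.err Tf l t ∈ U n :=
  mul_mem_U (conjTranspose_mem_U ((h.isTrajectory_Xbar hTf l).mem_U t ht)) (h.X_mem_U _ ht)

lemma Xbar_mul_err (h : IsExecution sys K E Xgoal α β p seed Tf r) (hTf : 0 ≤ Tf) (l : ℕ) {t : ℝ}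
    (ht : t ∈ Set.Icc 0 Tf) : r.Xbar Tf l t * r.err Tf l t = r.X (l + 1) t := by
  rw [Execution.err, ← Matrix.mul_assoc,
    mul_conjTranspose_self_of_mem_U ((h.isTrajectory_Xbar hTf l).mem_U t ht), Matrix.one_mul]

/-- The drift and the old input drive both the reference and the new trajectory and cancel in the
error; only the feedback correction remains. -/
lemma isClosedLoop_err (h : IsExecution sys K E Xgoal α β p seed Tf r) (hTf : 0 ≤ Tf) (l : ℕ) :
    IsClosedLoop sys K E Tf (r.Xbar Tf l) (r.err Tf l) := by
  intro t ht
  have h1 := (((h.isTrajectory_Xbar hTf l).deriv t ht).star).mul ((h.X_traj (l + 1)).deriv t ht)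
  refine h1.congr_deriv ?_
  have h2 : sys.gen (r.u (l + 1) t) = sys.gen (r.u l t) +
      ∑ k, feedback sys K E (r.Xbar Tf l t) (r.err Tf l t) k • sys.S k := by
    simp only [QSystem.gen, h.input l t ht, add_smul, Finset.sum_add_distrib, add_assoc]
    rfl
  rw [Matrix.star_eq_conjTranspose, Matrix.star_eq_conjTranspose, Matrix.conjTranspose_mul,
    sys.conjTranspose_gen, h2]
  have h3 : (∑ k, feedback sys K E (r.Xbar Tf l t) (r.err Tf l t) k •
      errS sys (r.Xbar Tf l t) k) = (r.Xbar Tf l t)ᴴ *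
        (∑ k, feedback sys K E (r.Xbar Tf l t) (r.err Tf l t) k • sys.S k) * r.Xbar Tf l t := by
    simp only [errS, Matrix.mul_sum, Matrix.sum_mul, Matrix.mul_smul, Matrix.smul_mul]
  rw [h3, Matrix.mul_assoc _ (r.Xbar Tf l t), h.Xbar_mul_err hTf l ht]
  simp only [Matrix.mul_add, Matrix.add_mul, Matrix.mul_neg, Matrix.neg_mul, Matrix.mul_assoc]
  abel

lemma d_nonneg (l : ℕ) : 0 ≤ r.d E Tf l := pdist_nonneg _ _ _

lemma d_succ_le (h : IsExecution sys K E Xgoal α β p seed Tf r) (l : ℕ) :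
    r.d E Tf (l + 1) ≤ β := (h.q_succ l).1.2.2

lemma Xbar_final (h : IsExecution sys K E Xgoal α β p seed Tf r) (hTf : 0 ≤ Tf) (l : ℕ) :
    r.Xbar Tf l Tf = r.goal (l + 1) := by
  rw [Execution.Xbar, ← Matrix.mul_assoc,
    mul_conjTranspose_self_of_mem_U (h.X_mem_U l (Set.right_mem_Icc.2 hTf)), Matrix.one_mul]

/-- Both trajectories start at the identity, so the initial error is the terminal miss of the
previous step, seen from the goal. -/
lemma pdist_err_zero (h : IsExecution sys K E Xgoal α β p seed Tf r) (l : ℕ) :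
    pdist E (r.err Tf l 0) 1 = r.d E Tf (l + 1) := by
  have h1 : r.goal (l + 1) * r.err Tf l 0 = r.X l Tf := by
    rw [Execution.err, Execution.Xbar, h.X_init, h.X_init, Matrix.one_mul, Matrix.mul_one,
      Matrix.conjTranspose_mul, Matrix.conjTranspose_conjTranspose, ← Matrix.mul_assoc,
      mul_conjTranspose_self_of_mem_U (h.goal_mem_U l), Matrix.one_mul]
  rw [← pdist_unitary_mul (h.goal_mem_U l), h1, Matrix.mul_one, pdist_comm]
  rfl

lemma pdist_err_final (h : IsExecution sys K E Xgoal α β p seed Tf r) (hTf : 0 ≤ Tf) (l : ℕ) :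
    pdist E (r.err Tf l Tf) 1 = pdist E (r.goal (l + 1)) (r.X (l + 1) Tf) := by
  have h1 := h.Xbar_mul_err hTf l (Set.right_mem_Icc.2 hTf)
  rw [h.Xbar_final hTf] at h1
  rw [← pdist_unitary_mul (h.goal_mem_U l), h1, Matrix.mul_one, pdist_comm]

lemma pdist_err_le (h : IsExecution sys K E Xgoal α β p seed Tf r) (hK : 0 < K)
    (hE : Eᴴ * E = 1) (l : ℕ) {t : ℝ} (ht : t ∈ Set.Icc 0 Tf) :
    pdist E (r.err Tf l t) 1 ≤ r.d E Tf (l + 1) := by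
  have hTf : 0 ≤ Tf := ht.1.trans ht.2
  have h0 : (0 : ℝ) ∈ Set.Icc 0 Tf := Set.left_mem_Icc.2 hTf
  have h1 := (h.isClosedLoop_err hTf l).antitoneOn_lyap hK h0 ht ht.1
  simp only at h1
  rw [lyap_eq_pdist_sq hE (h.err_mem_U hTf l ht), lyap_eq_pdist_sq hE (h.err_mem_U hTf l h0),
    h.pdist_err_zero] at h1
  exact le_of_sq_le_sq h1 (d_nonneg _)

/-- Attractivity of the reference makes the distance to the goal contract. -/
lemma d_contraction (h : IsExecution sys K E Xgoal α β p seed Tf r) (hTf : 0 ≤ Tf)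
    (hE : Eᴴ * E = 1) {θ : ℝ} {l : ℕ}
    (hatt : IsAttractive sys K E β θ Tf (r.u l) (r.Xbar Tf l)) (hq : r.q (l + 2) = r.q (l + 1)) :
    r.d E Tf (l + 2) ≤ √θ * r.d E Tf (l + 1) := by
  have h0 : (0 : ℝ) ∈ Set.Icc 0 Tf := Set.left_mem_Icc.2 hTf
  have h1 := hatt.attract _ (h.isClosedLoop_err hTf l)
    ⟨h.err_mem_U hTf l h0, by rw [h.pdist_err_zero]; exact h.d_succ_le l⟩
  rw [lyap_eq_pdist_sq hE (h.err_mem_U hTf l (Set.right_mem_Icc.2 hTf)),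
    lyap_eq_pdist_sq hE (h.err_mem_U hTf l h0), h.pdist_err_zero, h.pdist_err_final hTf,
    ← Real.sq_sqrt hatt.lam_pos.le, ← mul_pow] at h1
  -- Without a switching the goal is unchanged, so the terminal error of this step is the next
  -- distance.
  have h2 : r.d E Tf (l + 2) = pdist E (r.goal (l + 1)) (r.X (l + 1) Tf) := by
    simp only [Execution.d, Execution.goal, hq, Nat.add_succ_sub_one]
  rw [h2]
  exact le_of_sq_le_sq h1 (mul_nonneg (Real.sqrt_nonneg _) (d_nonneg _))

/-- The sum of all distances to the goals is bounded in terms of the number of goals. -/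
lemma sum_d_le (h : IsExecution sys K E Xgoal α β p seed Tf r) (hβ : 0 ≤ β)
    {ρ : ℝ} (hρ : 0 ≤ ρ) (hρ1 : ρ < 1) (l : ℕ)
    (hcontr : ∀ j, j + 1 < l → r.q (j + 2) = r.q (j + 1) →
      r.d E Tf (j + 2) ≤ ρ * r.d E Tf (j + 1)) :
    ∑ j ∈ Finset.range l, r.d E Tf (j + 1) ≤ p * β / (1 - ρ) := by
  rw [le_div_iff₀' (sub_pos.2 hρ1)]
  rcases l with _ | l
  · simp only [Finset.range_zero, Finset.sum_empty, mul_zero]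
    positivity
  have h1 := sum_le_of_contraction_off_jumps (D := fun j => r.d E Tf (j + 1))
    (Q := fun j => r.q (j + 1)) hρ (fun j => d_nonneg _) h.d_succ_le (h.one_le_q 0)
    (fun i j hij => h.monotone_q (Nat.succ_le_succ hij)) l
    (fun j hj => hcontr j (Nat.succ_lt_succ hj))
  have h2 : (r.q (l + 1) : ℝ) ≤ p := by exact_mod_cast h.q_le l
  have h3 := mul_le_mul_of_nonneg_right h2 hβ
  have h4 := mul_nonneg hρ (d_nonneg (E := E) (Tf := Tf) (r := r) (l + 1))
  linarith

lemma continuousOn_input (h : IsExecution sys K E Xgoal α β p seed Tf r) (hTf : 0 ≤ Tf)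
    (hseed : ∀ k, Continuous fun t => seed t k) (l : ℕ) (k : Fin m) :
    ContinuousOn (fun t => r.u l t k) (Set.Icc 0 Tf) := by
  induction l with
  | zero => exact (hseed k).continuousOn.congr fun t ht => by rw [h.seed_eq t ht]
  | succ l ih =>
    have h1 : Continuous fun YZ : Mat n × Mat n => feedback sys K E YZ.1 YZ.2 k := by
      unfold feedback errS
      fun_prop
    have h2 := h1.comp_continuousOn ((h.isTrajectory_Xbar hTf l).continuousOn.prodMk
      (fun t ht => (h.isClosedLoop_err hTf l t ht).continuousWithinAt))
    exact (ih.add h2).congr fun t ht => h.input l t ht k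

/-- Each step adds a feedback of size proportional to the current error, which never exceeds its
initial value $d_{j+1}$. -/
lemma abs_input_le (h : IsExecution sys K E Xgoal α β p seed Tf r) (hK : 0 < K)
    (hE : Eᴴ * E = 1) {μ₀ : ℝ} (hbound : ∀ t, 0 ≤ t → ∀ k, |seed t k| ≤ μ₀) (l : ℕ) {t : ℝ}
    (ht : t ∈ Set.Icc 0 Tf) (k : Fin m) :
    |r.u l t k| ≤ μ₀ + 2 * K * nb * ‖E‖ * ‖sys.S k‖ *
      ∑ j ∈ Finset.range l, r.d E Tf (j + 1) := by
  induction l with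
  | zero => simpa [h.seed_eq t ht] using hbound t ht.1 k
  | succ l ih =>
    rw [h.input l t ht, Finset.sum_range_succ, mul_add, ← add_assoc]
    refine (abs_add_le _ _).trans (add_le_add ih ?_)
    refine (abs_feedback_le hK sys E
      ((h.isTrajectory_Xbar (ht.1.trans ht.2) l).mem_U t ht) _ k).trans ?_
    gcongr
    exact h.pdist_err_le hK hE l ht

/-- The deviation of the propagators of the step `l` from those of the seed. -/
lemma norm_propagator_sub_le (h : IsExecution sys K E Xgoal α β p seed Tf r) (hK : 0 < K)
    (l : ℕ) {s t : ℝ} (hs : 0 ≤ s) (hst : s ≤ t) (ht : t ≤ Tf) :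
    ‖r.X l t * (r.X l s)ᴴ - r.X 0 t * (r.X 0 s)ᴴ‖ ≤ ∑ j ∈ Finset.range l,
      √((K * ∑ k, ‖sys.S k‖ ^ 2) * (t - s) *
        (lyap E (r.err Tf j s) - lyap E (r.err Tf j t))) := by
  have hTf : 0 ≤ Tf := hs.trans (hst.trans ht)
  have hsm : s ∈ Set.Icc 0 Tf := ⟨hs, hst.trans ht⟩
  have htm : t ∈ Set.Icc 0 Tf := ⟨hs.trans hst, ht⟩
  induction l with
  | zero => simp
  | succ l ih =>
    -- Up to unitary factors, one step changes the propagator by the displacement of its error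
    -- state; the constant right factor of the reference cancels. The steps then telescope.
    have h1 : r.X (l + 1) t * (r.X (l + 1) s)ᴴ - r.X l t * (r.X l s)ᴴ =
        r.Xbar Tf l t * ((r.err Tf l t - r.err Tf l s) * (r.X (l + 1) s)ᴴ) := by
      have h2 : r.Xbar Tf l t * (r.err Tf l s * (r.X (l + 1) s)ᴴ) = r.X l t * (r.X l s)ᴴ := by
        have hR := mul_conjTranspose_self_of_mem_U (mul_mem_U
          (conjTranspose_mem_U (h.X_mem_U l (Set.right_mem_Icc.2 hTf))) (h.goal_mem_U l))
        rw [Execution.err, Matrix.mul_assoc (r.Xbar Tf l s)ᴴ,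
          mul_conjTranspose_self_of_mem_U (h.X_mem_U (l + 1) hsm), Matrix.mul_one,
          Execution.Xbar, Execution.Xbar, Matrix.conjTranspose_mul (r.X l s),
          Matrix.mul_assoc (r.X l t), ← Matrix.mul_assoc _ _ (r.X l s)ᴴ, hR, Matrix.one_mul]
      rw [Matrix.sub_mul, Matrix.mul_sub, h2, ← Matrix.mul_assoc, h.Xbar_mul_err hTf l htm]
    have h3 : ‖r.X (l + 1) t * (r.X (l + 1) s)ᴴ - r.X l t * (r.X l s)ᴴ‖ =
        ‖r.err Tf l t - r.err Tf l s‖ := by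
      rw [h1, norm_unitary_mul ((h.isTrajectory_Xbar hTf l).mem_U t htm),
        norm_mul_unitary (conjTranspose_mem_U (h.X_mem_U (l + 1) hsm))]
    have h4 := Real.le_sqrt_of_sq_le ((h.isClosedLoop_err hTf l).norm_sub_sq_le hK
      (h.isTrajectory_Xbar hTf l).mem_U (h.err_mem_U hTf l (Set.left_mem_Icc.2 hTf)) hs hst ht)
    rw [Finset.sum_range_succ, ← sub_add_sub_cancel' (r.X l t * (r.X l s)ᴴ)]
    refine (norm_add_le _ _).trans (add_le_add ih ?_)
    rw [h3]
    exact h4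

/-- Some window of length `L` on which all steps before `l` change the propagators little. -/
lemma exists_window (h : IsExecution sys K E Xgoal α β p seed Tf r) (hK : 0 < K)
    (hE : Eᴴ * E = 1) {L : ℝ} (hL : 0 < L) {N : ℕ} (hN : 0 < N) (hNL : N * L ≤ Tf) (l : ℕ) :
    ∃ i < N, ∀ t ∈ Set.Icc 0 L,
      ‖r.X l (i * L + t) * (r.X l (i * L))ᴴ - r.X 0 (i * L + t) * (r.X 0 (i * L))ᴴ‖ ≤
        √(K * (∑ k, ‖sys.S k‖ ^ 2) * L) *
          ((∑ j ∈ Finset.range l, r.d E Tf (j + 1)) / √N) := by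
  have hTf : 0 ≤ Tf := le_trans (by positivity) hNL
  have hmem : ∀ i ≤ N, (i : ℝ) * L ∈ Set.Icc 0 Tf := fun i hi =>
    ⟨by positivity, le_trans (by gcongr) hNL⟩
  have hanti : ∀ j, AntitoneOn (fun t => lyap E (r.err Tf j t)) (Set.Icc 0 Tf) := fun j =>
    (h.isClosedLoop_err hTf j).antitoneOn_lyap hK
  obtain ⟨i, hi, hsum⟩ := exists_window_sum_sqrt_le
    (Δ := fun i j => lyap E (r.err Tf j (i * L)) - lyap E (r.err Tf j ((i + 1 : ℕ) * L)))
    (D := fun j => r.d E Tf (j + 1)) N l hN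
    (fun i hi j => by
      have hle : (i : ℝ) * L ≤ (i + 1 : ℕ) * L :=
        mul_le_mul_of_nonneg_right (Nat.cast_le.2 (Nat.le_succ i)) hL.le
      exact sub_nonneg.2 (hanti j (hmem i hi.le) (hmem (i + 1) hi) hle))
    (fun j => d_nonneg _)
    (fun j => by
      -- The decreases over consecutive windows telescope to at most the initial value $d_{j+1}^2$.
      rw [Finset.sum_range_sub' (fun i : ℕ => lyap E (r.err Tf j (i * L))), Nat.cast_zero,
        zero_mul, lyap_eq_pdist_sq hE (h.err_mem_U hTf j (Set.left_mem_Icc.2 hTf)),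
        lyap_eq_pdist_sq hE (h.err_mem_U hTf j (hmem N le_rfl)), h.pdist_err_zero]
      linarith [sq_nonneg (pdist E (r.err Tf j (N * L)) 1)])
  refine ⟨i, hi, fun t ht => ?_⟩
  have h1 := hmem i hi.le
  have h2 := hmem (i + 1) hi
  have h3 : ((i + 1 : ℕ) : ℝ) * L = i * L + L := by push_cast; ring
  have h4 : (i : ℝ) * L + t ≤ (i + 1 : ℕ) * L := by rw [h3]; linarith [ht.2]
  have h5 : (i : ℝ) * L + t ≤ Tf := h4.trans h2.2
  refine (h.norm_propagator_sub_le hK l h1.1 (by linarith [ht.1]) h5).trans ?_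
  refine le_trans ?_ (mul_le_mul_of_nonneg_left hsum (Real.sqrt_nonneg _))
  rw [Finset.mul_sum (Finset.range l)]
  refine Finset.sum_le_sum fun j _ => ?_
  -- By monotonicity the decrease on $[iL,iL+t]$ is at most that on the whole window.
  have h6 := hanti j ⟨h1.1.trans (by linarith [ht.1]), h5⟩ h2 h4
  have h7 := hanti j h1 ⟨h1.1.trans (by linarith [ht.1]), h5⟩ (by linarith [ht.1])
  simp only at h6 h7
  rw [← Real.sqrt_mul (by positivity)]
  refine Real.sqrt_le_sqrt ?_
  have h8 : (i : ℝ) * L + t - i * L ≤ L := by linarith [ht.2]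
  exact mul_le_mul (mul_le_mul_of_nonneg_left h8 (by positivity)) (by linarith) (by linarith)
    (by positivity)

/-- Attractivity of all references, from the robust contraction near seed trajectories. -/
lemma isAttractive (h : IsExecution sys K E Xgoal α β p seed Tf r) (hK : 0 < K)
    (hE : Eᴴ * E = 1) (hβ : 0 ≤ β) (hseed : ∀ k, Continuous fun t => seed t k)
    {L τ : ℝ} (hτ : 0 ≤ τ) (hL : 0 < L) (hτL : τ ≤ L)
    (hper : ∀ (i : ℕ) (t : ℝ), seed (i * L + t) = seed t) {N : ℕ} (hN : 0 < N)
    (hNL : N * L ≤ Tf) {ρ δ : ℝ} (hρ : 0 < ρ) (hρ1 : ρ < 1)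
    (hrob : ∀ Y Y' Z : ℝ → Mat n, (∀ t ∈ Set.Icc 0 τ, Y t ∈ U n) →
      IsTrajectory sys seed τ Y' → (∀ t ∈ Set.Icc 0 τ, ‖Y t - Y' t‖ ≤ δ) →
      IsClosedLoop sys K E τ Y Z → Z 0 ∈ pball E 1 β →
      pdist E (Z τ) 1 ≤ ρ * pdist E (Z 0) 1)
    (hδ : √(K * (∑ k, ‖sys.S k‖ ^ 2) * L) * ((p * β / (1 - ρ)) / √N) ≤ δ) (l : ℕ) :
    IsAttractive sys K E β (ρ ^ 2) Tf (r.u l) (r.Xbar Tf l) := by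
  have hTf : 0 ≤ Tf := le_trans (by positivity) hNL
  induction l using Nat.strong_induction_on with
  | _ l ih =>
  -- Only contractions at steps before `l` enter, and the induction hypothesis supplies them.
  have hsum : ∑ j ∈ Finset.range l, r.d E Tf (j + 1) ≤ p * β / (1 - ρ) := by
    refine h.sum_d_le hβ hρ.le hρ1 l fun j hj hq => ?_
    have h1 := h.d_contraction hTf hE (ih j ((Nat.lt_succ_self j).trans hj)) hq
    rwa [Real.sqrt_sq hρ.le] at h1
  have hbar := h.isTrajectory_Xbar hTf l
  refine ⟨by positivity, by nlinarith, h.continuousOn_input hTf hseed l, hbar, ?_⟩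
  intro Z hZ hZ0
  obtain ⟨i, hi, hclose⟩ := h.exists_window hK hE hL hN hNL l
  set s : ℝ := i * L with hs
  have hs0 : 0 ≤ s := by positivity
  have hsL : s + L ≤ Tf := by
    have h1 : ((i : ℝ) + 1) * L ≤ N * L := by
      gcongr
      exact_mod_cast hi
    linarith
  have hsτ : s + τ ≤ Tf := by linarith
  have hsm : s ∈ Set.Icc 0 Tf := ⟨hs0, by linarith⟩
  have hsτm : s + τ ∈ Set.Icc 0 Tf := ⟨by linarith, hsτ⟩
  have h0m : (0 : ℝ) ∈ Set.Icc 0 Tf := Set.left_mem_Icc.2 hTf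
  have hTm : Tf ∈ Set.Icc 0 Tf := Set.right_mem_Icc.2 hTf
  have hZU := hZ.mem_U hZ0.1
  have hanti := hZ.antitoneOn_lyap hK
  have hstart : lyap E (Z s) ≤ lyap E (Z 0) := hanti h0m hsm hs0
  have hend : lyap E (Z Tf) ≤ lyap E (Z (s + τ)) := hanti hsτm hTm hsτ
  -- The comparison trajectory is the seed's propagator started from the reference at time $s$;
  -- periodicity makes its input the seed on $[0,\tau]$.
  have hY' : IsTrajectory sys seed τ
      (fun t => r.X 0 (s + t) * ((r.X 0 s)ᴴ * r.Xbar Tf l s)) := by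
    refine (((h.X_traj 0).shift hs0 hτ hsτ).mul_const (mul_mem_U
      (conjTranspose_mem_U (h.X_mem_U 0 hsm)) (hbar.mem_U s hsm))).congr_input fun t ht => ?_
    rw [h.seed_eq _ ⟨by linarith [ht.1], by linarith [ht.2]⟩, hs, hper]
  have hnear : ∀ t ∈ Set.Icc 0 τ,
      ‖r.Xbar Tf l (s + t) - r.X 0 (s + t) * ((r.X 0 s)ᴴ * r.Xbar Tf l s)‖ ≤ δ := by
    intro t ht
    have h1 : r.Xbar Tf l (s + t) = r.X l (s + t) * ((r.X l s)ᴴ * r.Xbar Tf l s) := by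
      rw [Execution.Xbar, Execution.Xbar, ← Matrix.mul_assoc (r.X l s)ᴴ,
        conjTranspose_mul_self_of_mem_U (h.X_mem_U l hsm), Matrix.one_mul]
    rw [h1, ← Matrix.mul_assoc, ← Matrix.mul_assoc, ← Matrix.sub_mul,
      norm_mul_unitary (hbar.mem_U s hsm)]
    refine (hclose t ⟨ht.1, ht.2.trans hτL⟩).trans (le_trans ?_ hδ)
    gcongr
  have hball : Z (s + 0) ∈ pball E 1 β := by
    rw [add_zero]
    refine ⟨hZU s hsm, ?_⟩
    rw [lyap_eq_pdist_sq hE (hZU s hsm), lyap_eq_pdist_sq hE hZ0.1] at hstart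
    exact (le_of_sq_le_sq hstart (pdist_nonneg _ _ _)).trans hZ0.2
  have hcon := hrob _ _ _
    (fun t ht => hbar.mem_U (s + t) ⟨by linarith [ht.1], by linarith [ht.2]⟩) hY' hnear
    (hZ.shift hs0 hsτ) hball
  simp only [add_zero] at hcon
  calc lyap E (Z Tf) ≤ lyap E (Z (s + τ)) := hend
    _ = pdist E (Z (s + τ)) 1 ^ 2 := lyap_eq_pdist_sq hE (hZU _ hsτm)
    _ ≤ (ρ * pdist E (Z s) 1) ^ 2 := by
        have := pdist_nonneg E (Z (s + τ)) 1
        gcongr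
    _ = ρ ^ 2 * lyap E (Z s) := by rw [mul_pow, lyap_eq_pdist_sq hE (hZU s hsm)]
    _ ≤ ρ ^ 2 * lyap E (Z 0) := by gcongr

/-- While the goal index is below `p`, a later step switches to a larger one. -/
lemma exists_switch (h : IsExecution sys K E Xgoal α β p seed Tf r) (hαβ : α < β)
    {ρ : ℝ} (hρ : 0 ≤ ρ) (hρ1 : ρ < 1)
    (hcontr : ∀ j, r.q (j + 2) = r.q (j + 1) → r.d E Tf (j + 2) ≤ ρ * r.d E Tf (j + 1))
    {l : ℕ} (hl : r.q (l + 1) < p) : ∃ l', r.q (l + 1) < r.q (l' + 1) := by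
  by_contra! hno
  have hconst : ∀ k, r.q (l + k + 1) = r.q (l + 1) := fun k =>
    (hno (l + k)).antisymm (h.monotone_q (by lia))
  have hgeo : ∀ k, r.d E Tf (l + k + 1) ≤ ρ ^ k * r.d E Tf (l + 1) := by
    intro k
    induction k with
    | zero => simp
    | succ k ih =>
      have h1 := hcontr (l + k) ((hconst (k + 1)).trans (hconst k).symm)
      calc r.d E Tf (l + (k + 1) + 1) ≤ ρ * r.d E Tf (l + k + 1) := h1
        _ ≤ ρ * (ρ ^ k * r.d E Tf (l + 1)) := by gcongr
        _ = ρ ^ (k + 1) * r.d E Tf (l + 1) := by ring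
  have hlim : Filter.Tendsto (fun k => ρ ^ k * r.d E Tf (l + 1)) Filter.atTop (nhds 0) := by
    simpa using (tendsto_pow_atTop_nhds_zero_of_lt_one hρ hρ1).mul_const (r.d E Tf (l + 1))
  -- Once the distance is below $\beta-\alpha$, the next goal, at most $\alpha$ further, lies within
  -- $\beta$, and maximality of the chosen index forces a switching.
  obtain ⟨k, hk⟩ := (hlim.eventually_lt_const (sub_pos.2 hαβ)).exists
  have hd : pdist E (r.Xg (r.q (l + 1))) (r.X (l + k) Tf) ≤ β - α := by
    have h1 := (hgeo k).trans hk.le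
    simpa only [Execution.d, Execution.goal, hconst k, Nat.add_sub_cancel] using h1
  have hstep := h.goals.step _ hl
  have htri := pdist_triangle E (r.Xg (r.q (l + 1) + 1)) (r.Xg (r.q (l + 1))) (r.X (l + k) Tf)
  rw [pdist_comm] at hstep
  have hmem := (h.q_succ (l + k)).2 (show r.q (l + 1) + 1 ∈ _ from
    ⟨⟨Nat.le_add_left _ _, hl⟩,
      ((h.monotone_q (Nat.le_succ (l + k))).trans (hconst k).le).trans (Nat.le_succ _),
      by linarith⟩)
  have := hconst k
  lia

/-- The last goal is reached after finitely many steps. -/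
lemma exists_q_eq (h : IsExecution sys K E Xgoal α β p seed Tf r) (hαβ : α < β)
    {ρ : ℝ} (hρ : 0 ≤ ρ) (hρ1 : ρ < 1)
    (hcontr : ∀ j, r.q (j + 2) = r.q (j + 1) → r.d E Tf (j + 2) ≤ ρ * r.d E Tf (j + 1)) :
    ∃ l, r.q (l + 1) = p := by
  have key : ∀ k ≤ p, ∃ l, k ≤ r.q (l + 1) := by
    intro k
    induction k with
    | zero => exact fun _ => ⟨0, Nat.zero_le _⟩
    | succ k ih =>
      intro hk
      obtain ⟨l, hl⟩ := ih (Nat.le_of_succ_le hk)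
      rcases Nat.lt_or_ge (r.q (l + 1)) p with hlt | hge
      · obtain ⟨l', hl'⟩ := h.exists_switch hαβ hρ hρ1 hcontr hlt
        exact ⟨l', by lia⟩
      · exact ⟨l, by lia⟩
  obtain ⟨l, hl⟩ := key p le_rfl
  exact ⟨l, (h.q_le l).antisymm hl⟩

end IsExecution

end RIGA

/-! ### Choice of the constants and proof of the main theorem -/

theorem mainTheorem1 {n m nb : ℕ} (sys : RIGA.QSystem n m) (hctrl : sys.Controllable)
    (K : ℝ) (hK : 0 < K)
    (E F : Matrix (Fin n) (Fin nb) ℂ) (hE : Eᴴ * E = 1) (hF : Fᴴ * F = 1)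
    (Xgoal : RIGA.Mat n) (hXgoal : Xgoal ∈ RIGA.U n) (hgoal : Xgoal * E = F)
    (α β : ℝ) (hα : 0 < α) (hαβ : α < β) (hβ : β < 2)
    (T : ℝ) (hT : 0 < T) (M : ℕ) (a b : Fin m → Fin M → ℝ)
    -- the seed input is bounded
    (μ₀ : ℝ) (hμ₀ : 0 < μ₀)
    (hbound : ∀ t, 0 ≤ t → ∀ k, |RIGA.harmonicInput T a b t k| ≤ μ₀)
    -- the seed input is `lam`-attractive on some horizon, for every initial reference condition
    (T₀ lam : ℝ) (hT₀ : 0 < T₀) (hlam : 0 < lam) (hlam1 : lam < 1)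
    (hattr : ∀ Xbar : ℝ → RIGA.Mat n,
      RIGA.IsTrajectory sys (RIGA.harmonicInput T a b) T₀ Xbar →
      RIGA.IsAttractive sys K E β lam T₀ (RIGA.harmonicInput T a b) Xbar) :
    ∃ θ : ℝ, 0 < θ ∧ θ < 1 ∧ ∃ μbar : ℝ, 0 < μbar ∧
      ∀ p : ℕ, 1 ≤ p → ∃ Tstar : ℝ, 0 < Tstar ∧ ∀ Tf : ℝ, Tstar ≤ Tf →
        ∀ r : RIGA.Execution n m,
          RIGA.IsExecution sys K E Xgoal α β p (RIGA.harmonicInput T a b) Tf r →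
          -- (a)
          (∀ l, RIGA.IsAttractive sys K E β θ Tf (r.u l) (r.Xbar Tf l)) ∧
          -- (b)
          (∀ l, 1 ≤ l → r.d E Tf l ≤ β) ∧
          (∀ l, 1 ≤ l → r.q (l + 1) = r.q l → r.d E Tf (l + 1) ≤ √θ * r.d E Tf l) ∧
          (∃ lstar : ℕ, 1 ≤ lstar ∧
            (∀ l, lstar ≤ l → r.q l = p ∧ r.goal l = r.Xg p ∧
              r.d E Tf (l + 1) ≤ r.d E Tf l ∧
              r.d E Tf l ≤ √θ ^ (l - lstar) * r.d E Tf lstar)) ∧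
          Filter.Tendsto (r.d E Tf) Filter.atTop (nhds 0) ∧
          -- (c)
          (∀ l, ∀ t ∈ Set.Icc 0 Tf, ∀ k, |r.u l t k| ≤ μ₀ + p * μbar * β) := by
  have hβ0 : 0 < β := hα.trans hαβ
  have hsl : √lam < 1 := by
    rw [Real.sqrt_lt' one_pos, one_pow]
    exact hlam1
  -- The margin $\rho-\sqrt\lambda$ is reserved for perturbations; $\theta=\rho^2$ does not depend
  -- on $p$.
  obtain ⟨ρ, hρl, hρ1⟩ := exists_between hsl
  have hρ : 0 < ρ := (Real.sqrt_nonneg _).trans_lt hρl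
  have h1ρ : 0 < 1 - ρ := sub_pos.2 hρ1
  have hsqrt : √(ρ ^ 2) = ρ := Real.sqrt_sq hρ.le
  obtain ⟨δ, hδ, hrob⟩ := RIGA.exists_robust_contraction hK sys hE hT₀.le hattr hρl
  -- The window length is a multiple of the period not below $T_0$, so every window meets the seed
  -- in the same phase.
  obtain ⟨N₀, hN₀⟩ := exists_nat_gt (T₀ / T)
  set L : ℝ := N₀ * T with hLdef
  have hτL : T₀ ≤ L := ((div_lt_iff₀ hT).1 hN₀).le
  have hL : 0 < L := hT₀.trans_le hτL
  have hper : ∀ (i : ℕ) (t : ℝ),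
      RIGA.harmonicInput T a b (i * L + t) = RIGA.harmonicInput T a b t := by
    intro i t
    have h1 := RIGA.harmonicInput_periodic hT a b (i * N₀) t
    rwa [Nat.cast_mul, mul_assoc] at h1
  set c : ℝ := 2 * K * nb * ‖E‖ * ∑ k, ‖sys.S k‖ with hc
  have hc0 : 0 ≤ c := by positivity
  -- The denominator $1-\rho$ comes from $\sum_j d_j\le p\beta/(1-\rho)$; the summand $1$ only
  -- ensures $\overline\mu>0$.
  refine ⟨ρ ^ 2, by positivity, by nlinarith, (c + 1) / (1 - ρ), by positivity, ?_⟩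
  intro p _
  set B : ℝ := √(K * (∑ k, ‖sys.S k‖ ^ 2) * L) * (p * β / (1 - ρ)) with hB
  have hB0 : 0 ≤ B := by positivity
  -- This gives $B/\sqrt N\le\delta$. The number $p$ enters through $B$, hence only through the
  -- horizon.
  obtain ⟨N, hN⟩ := exists_nat_gt ((B / δ) ^ 2)
  have hN0 : 0 < N := by
    have : (0 : ℝ) < N := (sq_nonneg _).trans_lt hN
    exact_mod_cast this
  have hNδ : √(K * (∑ k, ‖sys.S k‖ ^ 2) * L) * ((p * β / (1 - ρ)) / √N) ≤ δ := by
    have hNs : 0 < √(N : ℝ) := Real.sqrt_pos.2 (by exact_mod_cast hN0)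
    rw [← mul_div_assoc, ← hB, div_le_iff₀ hNs, mul_comm, ← div_le_iff₀ hδ]
    exact Real.le_sqrt_of_sq_le hN.le
  refine ⟨N * L, mul_pos (by exact_mod_cast hN0) hL, fun Tf hTfN r hr => ?_⟩
  have hTf : 0 ≤ Tf := le_trans (by positivity) hTfN
  have hatt := hr.isAttractive hK hE hβ0.le (RIGA.continuous_harmonicInput T a b) hT₀.le hL hτL
    hper hN0 hTfN hρ hρ1 hrob hNδ
  have hcontr : ∀ j, r.q (j + 2) = r.q (j + 1) →
      r.d E Tf (j + 2) ≤ ρ * r.d E Tf (j + 1) := by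
    intro j hq
    have h1 := hr.d_contraction hTf hE (hatt j) hq
    rwa [hsqrt] at h1
  rw [hsqrt]
  obtain ⟨l₀, hl₀⟩ := hr.exists_q_eq hαβ hρ.le hρ1 hcontr
  have hq : ∀ k, r.q (l₀ + 1 + k) = p := fun k => by
    have h1 := hr.q_le (l₀ + k)
    have h2 := hr.monotone_q (show l₀ + 1 ≤ l₀ + k + 1 by lia)
    rw [show l₀ + 1 + k = l₀ + k + 1 by lia]
    lia
  have hstep : ∀ k, r.d E Tf (l₀ + 1 + k + 1) ≤ ρ * r.d E Tf (l₀ + 1 + k) := fun k => by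
    have h1 := hcontr (l₀ + k) (by
      rw [show l₀ + k + 2 = l₀ + 1 + (k + 1) by lia, show l₀ + k + 1 = l₀ + 1 + k by lia, hq, hq])
    rwa [show l₀ + k + 2 = l₀ + 1 + k + 1 by lia, show l₀ + k + 1 = l₀ + 1 + k by lia] at h1
  have hgeo : ∀ k, r.d E Tf (l₀ + 1 + k) ≤ ρ ^ k * r.d E Tf (l₀ + 1) := by
    intro k
    induction k with
    | zero => simp
    | succ k ih =>
      calc r.d E Tf (l₀ + 1 + (k + 1)) ≤ ρ * r.d E Tf (l₀ + 1 + k) := hstep k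
        _ ≤ ρ * (ρ ^ k * r.d E Tf (l₀ + 1)) := by gcongr
        _ = ρ ^ (k + 1) * r.d E Tf (l₀ + 1) := by ring
  refine ⟨hatt, ?_, ?_, ⟨l₀ + 1, Nat.le_add_left _ _, ?_⟩, ?_, ?_⟩
  · intro l hl
    obtain ⟨l, rfl⟩ := Nat.exists_eq_add_of_le' hl
    exact hr.d_succ_le l
  · intro l hl hql
    obtain ⟨l, rfl⟩ := Nat.exists_eq_add_of_le' hl
    exact hcontr l hql
  · intro l hl
    obtain ⟨k, rfl⟩ := Nat.exists_eq_add_of_le hl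
    refine ⟨hq k, by rw [RIGA.Execution.goal, hq k], ?_, ?_⟩
    · have h1 : 0 ≤ r.d E Tf (l₀ + 1 + k) := RIGA.IsExecution.d_nonneg _
      nlinarith [hstep k]
    · rw [Nat.add_sub_cancel_left]
      exact hgeo k
  · have hlim : Filter.Tendsto (fun k => ρ ^ k * r.d E Tf (l₀ + 1)) Filter.atTop (nhds 0) := by
      simpa using (tendsto_pow_atTop_nhds_zero_of_lt_one hρ.le hρ1).mul_const
        (r.d E Tf (l₀ + 1))
    rw [← Filter.tendsto_add_atTop_iff_nat (l₀ + 1)]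
    refine squeeze_zero (fun k => RIGA.IsExecution.d_nonneg _) (fun k => ?_) hlim
    rw [add_comm k]
    exact hgeo k
  · intro l t ht k
    refine (hr.abs_input_le hK hE hbound l ht k).trans ?_
    have hsum := hr.sum_d_le hβ0.le hρ.le hρ1 l fun j _ => hcontr j
    have hSk : ‖sys.S k‖ ≤ ∑ k, ‖sys.S k‖ :=
      Finset.single_le_sum (f := fun k => ‖sys.S k‖) (fun _ _ => norm_nonneg _)
        (Finset.mem_univ k)
    have hck : 2 * K * nb * ‖E‖ * ‖sys.S k‖ ≤ c + 1 := by
      have : 2 * K * nb * ‖E‖ * ‖sys.S k‖ ≤ c := by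
        rw [hc]
        gcongr
      linarith
    have hnn : 0 ≤ ∑ j ∈ Finset.range l, r.d E Tf (j + 1) :=
      Finset.sum_nonneg fun j _ => RIGA.IsExecution.d_nonneg _
    calc μ₀ + 2 * K * nb * ‖E‖ * ‖sys.S k‖ * ∑ j ∈ Finset.range l, r.d E Tf (j + 1)
        ≤ μ₀ + (c + 1) * (p * β / (1 - ρ)) := by gcongr
      _ = μ₀ + p * ((c + 1) / (1 - ρ)) * β := by ring
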